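/- Let $\mathcal X\subset\mathbb R^d$ be nonempty, compact and convex, $D=\max_{x,y\in\mathcal X}\|x-y\|_\infty$, let $\mu>0$, and put $\mathcal X_\mu=\{x:\operatorname{dist}(x,\mathcal X)\le\mu\}$. Let $\xi$ be a random element with law $P$, let $f(x;\xi)$ be jointly measurable with $\sup_{x\in\mathcal X_\mu}\mathbb E|f(x;\xi)|<\infty$, and let $f(x)=\mathbb E_\xi[f(x;\xi)]$. Assume that $f$ is convex and $L_c$-Lipschitz on $\mathcal X_\mu$ and $L$-smooth (differentiable with $L$-Lipschitz gradient) on the open set $\{x:\operatorname{dist}(x,\mathcal X)<\mu\}$, and let $x_\star\in\arg\min_{x\in\mathcal X}f(x)$. Let $(\xi_t,u_t)_{t\ge1}$ be i.i.d. pairs, where $\xi_t\sim P$ and $u_t$, uniform on the unit sphere of $\mathbb R^d$, are independent. Let $\alpha>0$, $0\le\beta_1<1$, $0<\beta_2<1$, $\gamma=\beta_1^2/\beta_2<1$, $\epsilon>0$, $x_1\in\mathcal X$. ZO-AdaMM starts from $m_0=v_0=0$, $\hat v_0=\epsilon\mathbf 1$, and for $t=1,2,\dots$ sets (all operations on vectors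 being coordinatewise) $$\hat g_t=\tfrac d\mu\,[f(x_t+\mu u_t;\xi_t)-f(x_t;\xi_t)]\,u_t,\qquad m_t=\beta_1m_{t-1}+(1-\beta_1)\hat g_t,\qquad v_t=\beta_2v_{t-1}+(1-\beta_2)\hat g_t^2,$$ $$\hat v_t=\max(\hat v_{t-1},v_t),\qquad x_{t+1}=\arg\min_{y\in\mathcal X}\ \sum_{i=1}^d\hat v_{t,i}^{1/2}\Big(y_i-x_{t,i}+\tfrac{\alpha}{\sqrt t}\,\hat v_{t,i}^{-1/2}m_{t,i}\Big)^2 .$$ Let $f_{t,\mu}(x)=\mathbb E_{w}[f(x+\mu w;\xi_t)]$, where $w$ is uniform on the unit ball and independent of everything else, the expectation being over $w$ only. Then for every $T\ge1$ the random variables $\sum_{t=1}^T\big(f_{t,\mu}(x_t)-f_{t,\mu}(x_\star)\big)$ and $\hat v_{T,i}^{1/2}$ are integrable and $$\mathbb E\Big[\sum_{t=1}^T f_{t,\mu}(x_t)-f_{t,\mu}(x_\star)\Big]\le\frac{D^2\sqrt T}{2\alpha(1-\beta_1)}\sum_{i=1}^d\mathbb E\big[\hat v_{T,i}^{1/2}\big]+\frac{\alpha\sqrt{1+\log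 T}}{\sqrt{(1-\beta_2)(1-\gamma)}}\sum_{i=1}^d\sqrt{\sum_{t=1}^T\mathbb E\big[\hat g_{t,i}^2\big]},$$ where the expectations of the nonnegative variables $\hat g_{t,i}^2$ take values in $[0,\infty]$. -/

import Mathlib

open MeasureTheory ProbabilityTheory
open scoped NNReal ENNReal

namespace ZOAdaMM

/-- Euclidean space `ℝ^d`. -/
abbrev E (d : ℕ) : Type := EuclideanSpace ℝ (Fin d)

/-- The uniform probability measure on the unit sphere of `ℝ^d` (normalized surface measure),
viewed as a measure on `ℝ^d`. -/
noncomputable def unifSphere (d : ℕ) : Measure (E d) :=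
  (cond (volume : Measure (E d)).toSphere Set.univ).map Subtype.val

/-- The uniform probability measure on the closed unit ball of `ℝ^d`. -/
noncomputable def unifBall (d : ℕ) : Measure (E d) :=
  cond (volume : Measure (E d)) (Metric.closedBall 0 1)

/-- `‖x‖_v^2 = ⟨x, diag(v) x⟩`. -/
noncomputable def weightedSqNorm {d : ℕ} (v x : E d) : ℝ := ∑ i, v i * x i ^ 2

/-- The weighted projection `argmin_{z ∈ X} ‖z - y‖_v^2`; the minimizer exists and is unique when
`X` is nonempty, compact and convex and all `v i` are positive. -/
noncomputable def weightedProj {d : ℕ} (X : Set (E d)) (v y : E d) : E d :=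
  Classical.epsilon fun z => z ∈ X ∧ IsMinOn (fun w => weightedSqNorm v (w - y)) X z

/-- The diameter `max_{x, y ∈ X} ‖x - y‖_∞` (the target `Fin d → ℝ` carries the sup norm). -/
noncomputable def supDiam {d : ℕ} (X : Set (E d)) : ℝ :=
  Metric.diam ((fun x : E d => (WithLp.ofLp x : Fin d → ℝ)) '' X)

/-- `L`-smoothness on an open set: differentiable with `L`-Lipschitz gradient. -/
def LSmoothOn {d : ℕ} (L : ℝ≥0) (F : E d → ℝ) (U : Set (E d)) : Prop :=
  DifferentiableOn ℝ F U ∧ LipschitzOnWith L (gradient F) U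

variable {d : ℕ} {Ξ : Type*}

/-- The two-point gradient estimator `(d/μ) [f(x + μ u; s) - f(x; s)] u`. -/
noncomputable def zoGrad (f : E d → Ξ → ℝ) (μ : ℝ) (x : E d) (s : Ξ) (u : E d) : E d :=
  ((d : ℝ) / μ * (f (x + μ • u) s - f x s)) • u

/-- The smoothed loss `𝔼_{u ∼ U_B} f(x + μ u; s)`, `u` uniform on the unit ball. -/
noncomputable def smoothed (f : E d → Ξ → ℝ) (μ : ℝ) (s : Ξ) (x : E d) : ℝ :=
  ∫ u, f (x + μ • u) s ∂(unifBall d)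

/-- Parameters of the method. -/
structure Params where
  α : ℝ
  β₁ : ℝ
  β₂ : ℝ
  ε : ℝ
  μ : ℝ

/-- Memory of the method after `t` steps: `x = x_{t+1}`, `m = m_t`, `v = v_t`, `vhat = v̂_t`. -/
structure State (d : ℕ) where
  x : E d
  m : E d
  v : E d
  vhat : E d

/-- Step `t ≥ 1` of AMSGrad with gradient input `g`, step size `α / √t`. -/
noncomputable def amsgradStep (p : Params) (X : Set (E d)) (t : ℕ) (g : E d) (S : State d) :
    State d :=
  let m : E d := p.β₁ • S.m + (1 - p.β₁) • g
  let v : E d := WithLp.toLp 2 fun i => p.β₂ * S.v i + (1 - p.β₂) * g i ^ 2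
  let vhat : E d := WithLp.toLp 2 fun i => max (S.vhat i) (v i)
  let y : E d := WithLp.toLp 2 fun i => S.x i - p.α / √(t : ℝ) * (m i / √(vhat i))
  { x := weightedProj X (WithLp.toLp 2 fun i => √(vhat i)) y
    m := m
    v := v
    vhat := vhat }

/-- ZO-AdaMM along a sequence of samples `ξ 1, ξ 2, …` and directions `u 1, u 2, …`, started at
`x₁` with `m_0 = v_0 = 0` and `v̂_0 = ε 𝟏`. -/
noncomputable def run (p : Params) (X : Set (E d)) (f : E d → Ξ → ℝ) (x₁ : E d)
    (ξ : ℕ → Ξ) (u : ℕ → E d) : ℕ → State d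
  | 0 => { x := x₁, m := 0, v := 0, vhat := WithLp.toLp 2 fun _ => p.ε }
  | t + 1 =>
    let S := run p X f x₁ ξ u t
    amsgradStep p X (t + 1) (zoGrad f p.μ S.x (ξ (t + 1)) (u (t + 1))) S

/-- The iterate `x_t`, for `t ≥ 1`. -/
noncomputable def iter (p : Params) (X : Set (E d)) (f : E d → Ξ → ℝ) (x₁ : E d)
    (ξ : ℕ → Ξ) (u : ℕ → E d) (t : ℕ) : E d :=
  (run p X f x₁ ξ u (t - 1)).x

/-- The gradient estimate `ĝ_t` used at step `t ≥ 1`. -/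
noncomputable def gradEst (p : Params) (X : Set (E d)) (f : E d → Ξ → ℝ) (x₁ : E d)
    (ξ : ℕ → Ξ) (u : ℕ → E d) (t : ℕ) : E d :=
  zoGrad f p.μ (iter p X f x₁ ξ u t) (ξ t) (u t)

/-- The second-moment vector `v̂_t`. -/
noncomputable def vHat (p : Params) (X : Set (E d)) (f : E d → Ξ → ℝ) (x₁ : E d)
    (ξ : ℕ → Ξ) (u : ℕ → E d) (t : ℕ) : E d :=
  (run p X f x₁ ξ u t).vhat

/-- The smoothed regret `∑_{t=1}^T (f_{t,μ}(x_t) - f_{t,μ}(z))` with `f_t = f(·; ξ_t)`. -/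
noncomputable def smoothedRegret (p : Params) (X : Set (E d)) (f : E d → Ξ → ℝ) (x₁ : E d)
    (ξ : ℕ → Ξ) (u : ℕ → E d) (T : ℕ) (z : E d) : ℝ :=
  ∑ t ∈ Finset.Icc 1 T,
    (smoothed f p.μ (ξ t) (iter p X f x₁ ξ u t) - smoothed f p.μ (ξ t) z)

end ZOAdaMM

open ZOAdaMM

/-! Two facts are combined: a pathwise regret bound for AMSGrad, valid for every sequence of inputs
`g`, and the fact that the two-point estimator is on average a gradient of a smoothed convex
function.

The stochastic side: `x_t` is a function of the samples before time `t`, hence independent of `(ξ_t,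
u_t)`. Averaging first over `ξ_t` replaces `f(·; ξ_t)` by `F`, so convexity and Lipschitz bounds are
needed for `F` only. For fixed `x`, the divergence theorem on the unit ball turns the spherical
average of `(d/μ)(F(x+μu) - F(x))⟨u, x - z⟩` into the ball average of `DF(x+μw)(x - z)`, and by
convexity this dominates the ball average of `F(x+μw) - F(z+μw)`
(`integral_unifBall_sub_le_integral_unifSphere`). Thus the expected smoothed gap at time `t` is at
most the expectation of `⟨ĝ_t, x_t - z⟩` (`integral_smoothed_sub_le`).

The pathwise side (`amsgrad_sum_inner_le`): with `c = β₁/(1-β₁)` one has `g_t = (1+c) m_t - c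
m_{t-1}`. So `⟨g_t, x_t - w⟩` is `⟨m_t, x_t - w⟩`, plus a telescoping term, plus the drift
`c⟨m_{t-1}, x_{t-1} - x_t⟩`. Optimality of the projection bounds the first by a telescoping weighted
distance and the drift by `m²/√v̂`. The weights `√t √v̂_t` grow, which costs only the squared
diameter. Finally `m_t²/√v̂_t` is at most a multiple of an exponential average of the `|g_s|`,
because `v_t` dominates the square of that average; Cauchy–Schwarz against `1/√t` produces `√(1 +
log T)`.

Only first moments of the losses are controlled, so the second moments of `ĝ_t` may be infinite; the
last comparison is therefore made in `[0, ∞]`, with Jensen for the square root. -/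

namespace ZOAdaMM

/-! ### The divergence theorem on the unit ball for Lipschitz functions. -/

section Divergence

open Metric Set Filter Topology

variable {V : Type*} [NormedAddCommGroup V]

theorem lipschitzWith_max_sub_norm (ρ : ℝ) :
    LipschitzWith 1 (fun w : V => max (ρ - ‖w‖) 0) := by
  have h : LipschitzWith 1 (fun w : V => ρ - ‖w‖) := by
    refine LipschitzWith.of_dist_le_mul fun x y => ?_
    have := abs_norm_sub_norm_le y x
    rw [Real.dist_eq, dist_eq_norm_sub, norm_sub_rev]
    simpa using this
  exact h.max_const 0

variable [InnerProductSpace ℝ V]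

theorem lineDeriv_max_sub_norm {ρ : ℝ} {w : V} (hw : w ≠ 0) (hρ : ‖w‖ ≠ ρ) (v : V) :
    lineDeriv ℝ (fun w : V => max (ρ - ‖w‖) 0) w (-v) =
      (ball (0 : V) ρ).indicator (fun w => inner ℝ w v / ‖w‖) w := by
  rcases lt_or_gt_of_ne hρ with h | h
  · have hev : (fun w : V => max (ρ - ‖w‖) 0) =ᶠ[𝓝 w] fun w => ρ - ‖w‖ := by
      filter_upwards [(continuous_norm.tendsto w).eventually (gt_mem_nhds h)] with y hy
      exact max_eq_left (by linarith)
    rw [hev.lineDeriv_eq, indicator_of_mem (by simpa using h)]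
    have h1 : HasDerivAt (fun t : ℝ => ‖w + t • (-v)‖ ^ 2) (2 * inner ℝ w (-v)) 0 := by
      have h2 : HasDerivAt (fun t : ℝ => w + t • (-v)) (-v) 0 := by
        simpa using ((hasDerivAt_id (0 : ℝ)).smul_const (-v)).const_add w
      simpa using h2.norm_sq
    have h3 : HasDerivAt (fun t : ℝ => ρ - √(‖w + t • (-v)‖ ^ 2))
        (-(2 * inner ℝ w (-v) / (2 * √(‖w + (0 : ℝ) • (-v)‖ ^ 2)))) 0 :=
      (h1.sqrt (by simpa using hw)).const_sub ρ
    simp only [Real.sqrt_sq (norm_nonneg _)] at h3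
    have h4 := h3.deriv
    rw [lineDeriv, h4]
    have : ‖w‖ ≠ 0 := by simpa using hw
    simp only [zero_smul, add_zero, inner_neg_right]
    field_simp
  · have hev : (fun w : V => max (ρ - ‖w‖) 0) =ᶠ[𝓝 w] fun _ => 0 := by
      filter_upwards [(continuous_norm.tendsto w).eventually (lt_mem_nhds h)] with y hy
      exact max_eq_right (by linarith)
    rw [hev.lineDeriv_eq, indicator_of_notMem (by simpa using h.le)]
    simp [lineDeriv]

variable [FiniteDimensional ℝ V]

theorem hasCompactSupport_max_sub_norm (ρ : ℝ) :
    HasCompactSupport (fun w : V => max (ρ - ‖w‖) 0) := by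
  refine HasCompactSupport.intro (isCompact_closedBall (0 : V) ρ) fun x hx => ?_
  have : ρ < ‖x‖ := by simpa using hx
  exact max_eq_right (by linarith)

variable [Nontrivial V] [MeasurableSpace V] [BorelSpace V] (ν : Measure V) [ν.IsAddHaarMeasure]

/-- Integration in polar coordinates. -/
theorem integral_eq_integral_Ioi_mul_integral_toSphere {h : V → ℝ} (hh : Integrable h ν) :
    ∫ w, h w ∂ν = ∫ r in Ioi (0 : ℝ), r ^ (Module.finrank ℝ V - 1) *
      ∫ θ : sphere (0 : V) 1, h (r • (θ : V)) ∂ν.toSphere := by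
  have hmp := ν.measurePreserving_homeomorphUnitSphereProd
  have hemb : MeasurableEmbedding (homeomorphUnitSphereProd V) :=
    Homeomorph.measurableEmbedding _
  set q : sphere (0 : V) 1 × Ioi (0 : ℝ) → ℝ := fun x => h ((x.2 : ℝ) • (x.1 : V)) with hq
  have hcomp : ∀ x : ({(0 : V)}ᶜ : Set V), q (homeomorphUnitSphereProd V x) = h x := by
    rintro ⟨x, hx⟩
    have hx0 : ‖x‖ ≠ 0 := by simpa using hx
    simp [hq, smul_smul, hx0]
  have hint : Integrable q (ν.toSphere.prod (.volumeIoiPow (Module.finrank ℝ V - 1))) := by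
    rw [← hmp.integrable_comp_emb hemb]
    have : q ∘ (homeomorphUnitSphereProd V) = h ∘ Subtype.val := funext hcomp
    rw [this, ← integrableOn_iff_comap_subtypeVal (measurableSet_singleton _).compl]
    exact hh.integrableOn
  calc ∫ w, h w ∂ν = ∫ x : ({(0 : V)}ᶜ : Set V), h x ∂(ν.comap (↑)) := by
        rw [integral_subtype_comap (measurableSet_singleton _).compl h, restrict_compl_singleton]
    _ = ∫ x, q x ∂ν.toSphere.prod (.volumeIoiPow (Module.finrank ℝ V - 1)) := by
        rw [← hmp.integral_comp hemb]
        exact integral_congr_ae (Eventually.of_forall fun x => (hcomp x).symm)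
    _ = ∫ r : Ioi (0 : ℝ), (∫ θ : sphere (0 : V) 1, h ((r : ℝ) • (θ : V)) ∂ν.toSphere)
          ∂(.volumeIoiPow (Module.finrank ℝ V - 1)) := by
        rw [integral_prod_symm _ hint]
    _ = _ := by
        simp only [Measure.volumeIoiPow, ENNReal.ofReal]
        rw [integral_withDensity_eq_integral_smul, integral_subtype_comap measurableSet_Ioi
          fun a : ℝ ↦ Real.toNNReal (a ^ (Module.finrank ℝ V - 1)) •
            ∫ θ : sphere (0 : V) 1, h (a • (θ : V)) ∂ν.toSphere,
          setIntegral_congr_fun measurableSet_Ioi fun x hx ↦ ?_]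
        · rw [NNReal.smul_def, Real.coe_toNNReal _ (pow_nonneg hx.out.le _), smul_eq_mul]
        · exact (measurable_subtype_coe.pow_const _).real_toNNReal

/-- The cone `max (ρ - ‖w‖) 0` is a Lipschitz cutoff whose derivative along `-v` is `⟨w, v⟩/‖w‖`
inside the ball. Integrating by parts against it and passing to polar coordinates leaves spherical
integrals over all radii below `ρ`. -/
theorem integral_lineDeriv_mul_max_sub_norm {K : ℝ≥0} {G : V → ℝ} (hG : LipschitzWith K G) (v : V)
    {ρ : ℝ} (hρ : 0 < ρ) :
    ∫ w, lineDeriv ℝ G w v * max (ρ - ‖w‖) 0 ∂ν =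
      ∫ r in (0 : ℝ)..ρ, r ^ (Module.finrank ℝ V - 1) *
        ∫ θ : sphere (0 : V) 1, inner ℝ (θ : V) v * G (r • (θ : V)) ∂ν.toSphere := by
  rw [hG.integral_lineDeriv_mul_eq (lipschitzWith_max_sub_norm ρ)
    (hasCompactSupport_max_sub_norm ρ) v]
  set h : V → ℝ := (ball (0 : V) ρ).indicator (fun w => inner ℝ w v / ‖w‖ * G w) with hh
  have hGc : Continuous G := hG.continuous
  have hae : (fun w => lineDeriv ℝ (fun w : V => max (ρ - ‖w‖) 0) w (-v) * G w) =ᵐ[ν] h := by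
    have h0 : ∀ᵐ w ∂ν, w ≠ 0 := by simp [ae_iff]
    have h1 : ∀ᵐ w ∂ν, w ∉ sphere (0 : V) ρ :=
      measure_eq_zero_iff_ae_notMem.1 (Measure.addHaar_sphere ν 0 ρ)
    filter_upwards [h0, h1] with w hw0 hw1
    rw [lineDeriv_max_sub_norm hw0 (by simpa using hw1), hh]
    by_cases hw : w ∈ ball (0 : V) ρ <;> simp [hw]
  have hint : Integrable h ν := by
    rw [hh, integrable_indicator_iff measurableSet_ball]
    obtain ⟨C, hC⟩ := (isCompact_closedBall (0 : V) ρ).exists_bound_of_continuousOn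
      hGc.continuousOn
    refine Measure.integrableOn_of_bounded (M := ‖v‖ * C) (measure_ball_lt_top.ne) ?_ ?_
    · exact (((measurable_id.inner_const).div measurable_norm).mul
        hGc.measurable).aestronglyMeasurable
    · filter_upwards [ae_restrict_mem measurableSet_ball] with w hw
      have hC' := hC w (ball_subset_closedBall hw)
      rw [norm_mul]
      refine mul_le_mul ?_ hC' (norm_nonneg _) (norm_nonneg _)
      rw [norm_div, norm_norm]
      refine div_le_of_le_mul₀ (norm_nonneg _) (norm_nonneg _) ?_
      rw [mul_comm]
      exact norm_inner_le_norm w v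
  rw [integral_congr_ae hae, integral_eq_integral_Ioi_mul_integral_toSphere ν hint,
    intervalIntegral.integral_of_le hρ.le, integral_Ioc_eq_integral_Ioo, ← Ioi_inter_Iio,
    ← setIntegral_indicator measurableSet_Iio]
  refine setIntegral_congr_fun measurableSet_Ioi fun r (hr : 0 < r) => ?_
  have hnorm : ∀ θ : sphere (0 : V) 1, ‖r • (θ : V)‖ = r := fun θ => by
    simp [norm_smul, abs_of_pos hr]
  by_cases hrρ : r < ρ
  · simp only [indicator_of_mem (mem_Iio.2 hrρ)]
    congr 1
    refine integral_congr_ae (Eventually.of_forall fun θ => ?_)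
    simp only [hh]
    rw [indicator_of_mem (by simpa [hnorm] using hrρ), hnorm, real_inner_smul_left]
    field_simp
  · simp only [indicator_of_notMem (fun h => hrρ (mem_Iio.1 h))]
    have : ∀ θ : sphere (0 : V) 1, h (r • (θ : V)) = 0 := fun θ => by
      rw [hh, indicator_of_notMem]
      simpa [hnorm] using hrρ
    simp [this]

/-- Differentiate the cone identity in `ρ` at `ρ = 1`. The `ρ`-derivative of the cone is the
indicator of the ball, while the fundamental theorem of calculus extracts the sphere of radius one
on the other side. -/
theorem setIntegral_ball_lineDeriv_eq_integral_toSphere {K : ℝ≥0} {G : V → ℝ}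
    (hG : LipschitzWith K G) (v : V) :
    ∫ w in ball (0 : V) 1, lineDeriv ℝ G w v ∂ν =
      ∫ θ : sphere (0 : V) 1, inner ℝ (θ : V) v * G θ ∂ν.toSphere := by
  set A : ℝ → ℝ := fun r => r ^ (Module.finrank ℝ V - 1) *
        ∫ θ : sphere (0 : V) 1, inner ℝ (θ : V) v * G (r • (θ : V)) ∂ν.toSphere with hA
  have hAc : Continuous A := by
    refine (continuous_pow _).mul ?_
    have hGc := hG.continuous
    have hc : Continuous (Function.uncurry fun (r : ℝ) (θ : sphere (0 : V) 1) =>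
        inner ℝ (θ : V) v * G (r • (θ : V))) := by
      unfold Function.uncurry
      fun_prop
    simpa using continuous_parametric_integral_of_continuous (μ := ν.toSphere) hc isCompact_univ
  have h1 : HasDerivAt (fun ρ => ∫ w, lineDeriv ℝ G w v * max (ρ - ‖w‖) 0 ∂ν) (A 1) 1 := by
    have h2 : HasDerivAt (fun ρ => ∫ r in (0 : ℝ)..ρ, A r) (A 1) 1 :=
      intervalIntegral.integral_hasDerivAt_right (hAc.intervalIntegrable _ _)
        (hAc.stronglyMeasurableAtFilter _ _) hAc.continuousAt
    refine h2.congr_of_eventuallyEq ?_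
    filter_upwards [lt_mem_nhds (zero_lt_one : (0 : ℝ) < 1)] with ρ hρ
    exact integral_lineDeriv_mul_max_sub_norm ν hG v hρ
  have hm : Measurable (fun w => lineDeriv ℝ G w v) := measurable_lineDeriv hG.continuous
  have h3 : HasDerivAt (fun ρ => ∫ w, lineDeriv ℝ G w v * max (ρ - ‖w‖) 0 ∂ν)
      (∫ w, (ball (0 : V) 1).indicator (fun w => lineDeriv ℝ G w v) w ∂ν) 1 := by
    -- For `ρ` in `ball 1 1`, that is `0 < ρ < 2`, every cone vanishes outside the ball of radius 2,
    -- which gives an integrable Lipschitz bound.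
    refine (hasDerivAt_integral_of_dominated_loc_of_lip (s := ball 1 1)
      (bound := (ball (0 : V) 2).indicator fun _ => K * ‖v‖) (ball_mem_nhds _ one_pos)
      ?_ ?_ ?_ ?_ ?_ ?_).2
    · refine Eventually.of_forall fun ρ => ?_
      exact (hm.mul (by fun_prop)).aestronglyMeasurable
    · refine Integrable.bdd_mul (c := K * ‖v‖) ?_ hm.aestronglyMeasurable
        (Eventually.of_forall fun w => norm_lineDeriv_le_of_lipschitz ℝ hG)
      exact (lipschitzWith_max_sub_norm 1).continuous.integrable_of_hasCompactSupport
        (hasCompactSupport_max_sub_norm 1)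
    · exact (hm.indicator measurableSet_ball).aestronglyMeasurable
    · refine Eventually.of_forall fun w => LipschitzOnWith.of_dist_le_mul fun ρ hρ ρ' hρ' => ?_
      have hb : ‖lineDeriv ℝ G w v‖ ≤ K * ‖v‖ := norm_lineDeriv_le_of_lipschitz ℝ hG
      rw [dist_eq_norm_sub, ← mul_sub, norm_mul]
      by_cases hw : w ∈ ball (0 : V) 2
      · rw [indicator_of_mem hw, Real.coe_nnabs, abs_of_nonneg (by positivity)]
        refine mul_le_mul hb ?_ (norm_nonneg _) (by positivity)
        have := abs_max_sub_max_le_abs (ρ - ‖w‖) (ρ' - ‖w‖) 0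
        rw [Real.dist_eq]
        simpa using this
      · have h2 : 2 ≤ ‖w‖ := by simpa using hw
        have h3 : ρ < 2 := by have := (abs_lt.1 (mem_ball_iff_norm.1 hρ)).2; linarith
        have h4 : ρ' < 2 := by have := (abs_lt.1 (mem_ball_iff_norm.1 hρ')).2; linarith
        rw [max_eq_right (by linarith), max_eq_right (by linarith)]
        simp [hw]
    · rw [integrable_indicator_iff measurableSet_ball]
      exact integrableOn_const measure_ball_lt_top.ne
    · have h1 : ∀ᵐ w ∂ν, w ∉ sphere (0 : V) 1 :=
        measure_eq_zero_iff_ae_notMem.1 (Measure.addHaar_sphere ν 0 1)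
      filter_upwards [h1] with w hw
      have hw : ‖w‖ ≠ 1 := by simpa using hw
      rcases lt_or_gt_of_ne hw with h | h
      · rw [indicator_of_mem (by simpa using h)]
        have h5 : HasDerivAt (fun ρ : ℝ => lineDeriv ℝ G w v * (ρ - ‖w‖))
            (lineDeriv ℝ G w v * 1) 1 := ((hasDerivAt_id _).sub_const _).const_mul _
        rw [mul_one] at h5
        refine h5.congr_of_eventuallyEq ?_
        filter_upwards [lt_mem_nhds h] with ρ hρ
        rw [max_eq_left (by linarith)]
      · rw [indicator_of_notMem (by simpa using h.le)]
        refine (hasDerivAt_const (1 : ℝ) (0 : ℝ)).congr_of_eventuallyEq ?_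
        filter_upwards [gt_mem_nhds h] with ρ hρ
        rw [max_eq_right (by linarith), mul_zero]
  have h4 := h3.unique h1
  rw [integral_indicator measurableSet_ball] at h4
  rw [h4, hA]
  simp

end Divergence

/-! ### Ball smoothing and the two-point estimator. -/

section Smoothing

open Metric Set

variable {d : ℕ}

instance isProbabilityMeasure_unifBall : IsProbabilityMeasure (unifBall d) :=
  cond_isProbabilityMeasure_of_finite (measure_closedBall_pos _ _ one_pos).ne'
    measure_closedBall_lt_top.ne

instance isProbabilityMeasure_unifSphere [NeZero d] : IsProbabilityMeasure (unifSphere d) := by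
  have : IsProbabilityMeasure (cond (volume : Measure (E d)).toSphere Set.univ) :=
    cond_isProbabilityMeasure_of_finite 
      (mt Measure.measure_univ_eq_zero.1 (Measure.toSphere_ne_zero _)) (measure_ne_top _ _)
  exact Measure.isProbabilityMeasure_map measurable_subtype_coe.aemeasurable

theorem ae_norm_le_one_unifBall : ∀ᵐ w ∂unifBall d, ‖w‖ ≤ 1 := by
  filter_upwards [ae_cond_mem (μ := (volume : Measure (E d))) measurableSet_closedBall] with w hw
  simpa using hw

theorem ae_norm_lt_one_unifBall [NeZero d] : ∀ᵐ w ∂unifBall d, ‖w‖ < 1 := by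
  have h1 : ∀ᵐ w ∂unifBall d, w ∉ sphere (0 : E d) 1 :=
    cond_absolutelyContinuous.ae_le
      (measure_eq_zero_iff_ae_notMem.1 (Measure.addHaar_sphere (volume : Measure (E d)) 0 1))
  filter_upwards [ae_norm_le_one_unifBall, h1] with w hw hw1
  exact lt_of_le_of_ne hw (by simpa using hw1)

theorem ae_norm_eq_one_unifSphere : ∀ᵐ u ∂unifSphere d, ‖u‖ = 1 := by
  rw [unifSphere, (MeasurableEmbedding.subtype_coe isClosed_sphere.measurableSet).ae_map_iff]
  exact Filter.Eventually.of_forall fun u => by simp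

theorem integral_unifBall (h : E d → ℝ) [NeZero d] :
    ∫ w, h w ∂unifBall d =
      (volume.real (ball (0 : E d) 1))⁻¹ * ∫ w in ball (0 : E d) 1, h w := by
  have hae : closedBall (0 : E d) 1 =ᵐ[volume] ball (0 : E d) 1 :=
    Filter.EventuallyEq.symm (ae_eq_of_subset_of_measure_ge ball_subset_closedBall
      (Measure.addHaar_closedBall_eq_addHaar_ball volume 0 1).le
      measurableSet_ball.nullMeasurableSet measure_closedBall_lt_top.ne)
  rw [unifBall, ProbabilityTheory.cond, integral_smul_measure, Measure.restrict_congr_set hae,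
    measure_congr hae, ENNReal.toReal_inv, smul_eq_mul, Measure.real]

theorem integral_unifSphere [NeZero d] (h : E d → ℝ) :
    ∫ u, h u ∂unifSphere d = ((d : ℝ) * volume.real (ball (0 : E d) 1))⁻¹ *
      ∫ θ : sphere (0 : E d) 1, h θ ∂(volume : Measure (E d)).toSphere := by
  rw [unifSphere, (MeasurableEmbedding.subtype_coe isClosed_sphere.measurableSet).integral_map]
  rw [ProbabilityTheory.cond, Measure.restrict_univ, integral_smul_measure, ENNReal.toReal_inv,
    smul_eq_mul, ← Measure.real, Measure.toSphere_real_apply_univ, finrank_euclideanSpace_fin]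

theorem add_smul_mem_cthickening {μ : ℝ} (hμ : 0 < μ) {X : Set (E d)} {x w : E d} (hx : x ∈ X)
    (hw : ‖w‖ ≤ 1) : x + μ • w ∈ cthickening μ X := by
  refine mem_cthickening_of_dist_le _ x _ _ hx ?_
  rw [dist_eq_norm_sub, add_sub_cancel_left, norm_smul, Real.norm_of_nonneg hμ.le]
  exact mul_le_of_le_one_right hμ.le hw

theorem add_smul_mem_thickening {μ : ℝ} (hμ : 0 < μ) {X : Set (E d)} {x w : E d} (hx : x ∈ X)
    (hw : ‖w‖ < 1) : x + μ • w ∈ thickening μ X := by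
  refine mem_thickening_iff.2 ⟨x, hx, ?_⟩
  rw [dist_eq_norm_sub, add_sub_cancel_left, norm_smul, Real.norm_of_nonneg hμ.le]
  exact mul_lt_of_lt_one_right hμ hw

theorem sub_le_fderiv_of_convexOn {V : Type*} [NormedAddCommGroup V] [NormedSpace ℝ V] {S : Set V}
    {F : V → ℝ} (hF : ConvexOn ℝ S F) {x y : V} (hx : x ∈ S) (hy : y ∈ S)
    (hd : DifferentiableAt ℝ F x) : F x - F y ≤ fderiv ℝ F x (x - y) := by
  have hc : ConvexOn ℝ (AffineMap.lineMap y x ⁻¹' S) (F ∘ AffineMap.lineMap (k := ℝ) y x) :=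
    hF.comp_affineMap _
  have hder : HasDerivAt (F ∘ AffineMap.lineMap (k := ℝ) y x) (fderiv ℝ F x (x - y)) 1 := by
    have h1 : HasDerivAt (AffineMap.lineMap (k := ℝ) y x) (x - y) (1 : ℝ) :=
      AffineMap.hasDerivAt_lineMap
    have h2 : HasFDerivAt F (fderiv ℝ F x) (AffineMap.lineMap (k := ℝ) y x 1) := by
      simpa using hd.hasFDerivAt
    exact h2.comp_hasDerivAt (1 : ℝ) h1
  have := hc.slope_le_deriv (x := 0) (y := 1) (by simpa using hy) (by simpa using hx) one_pos
    hder.differentiableAt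
  rw [hder.deriv] at this
  simpa [slope_def_field] using this

/-- The two-point estimator is, in expectation over the sphere, a subgradient of the ball-smoothed
convex function. -/
theorem integral_unifBall_sub_le_integral_unifSphere [NeZero d] {μ : ℝ} (hμ : 0 < μ)
    {X : Set (E d)} {F : E d → ℝ} (hconv : ConvexOn ℝ (cthickening μ X) F)
    (hdiff : DifferentiableOn ℝ F (thickening μ X)) {K : ℝ≥0}
    (hlip : LipschitzOnWith K F (cthickening μ X)) {x z : E d} (hx : x ∈ X) (hz : z ∈ X) :
    ∫ w, F (x + μ • w) ∂unifBall d - ∫ w, F (z + μ • w) ∂unifBall d ≤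
      ∫ u, (d : ℝ) / μ * (F (x + μ • u) - F x) * inner ℝ u (x - z) ∂unifSphere d := by
  have hmaps : ∀ y ∈ X, MapsTo (fun w : E d => y + μ • w) (closedBall 0 1) (cthickening μ X) :=
    fun y hy w hw => add_smul_mem_cthickening hμ hy (by simpa using hw)
  have hint : ∀ y ∈ X, Integrable (fun w => F (y + μ • w)) (unifBall d) := by
    intro y hy
    have hc : ContinuousOn (fun w => F (y + μ • w)) (closedBall 0 1) :=
      hlip.continuousOn.comp (by fun_prop) (hmaps y hy)
    have := hc.integrableOn_compact (μ := volume) (isCompact_closedBall _ _)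
    exact this.smul_measure (ENNReal.inv_ne_top.2 (measure_closedBall_pos _ _ one_pos).ne')
  have hLip : LipschitzOnWith (K * μ.toNNReal) (fun w => F (x + μ • w) - F x)
      (closedBall 0 1) := by
    refine LipschitzOnWith.of_dist_le_mul fun a ha b hb => ?_
    have := hlip.dist_le_mul _ (hmaps x hx ha) _ (hmaps x hx hb)
    rw [dist_sub_right]
    refine this.trans (le_of_eq ?_)
    rw [dist_add_left, dist_smul₀, Real.norm_of_nonneg hμ.le]
    rw [NNReal.coe_mul, Real.coe_toNNReal _ hμ.le, mul_assoc]
  -- The divergence identity needs a globally Lipschitz function, while `F` is controlled only near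
  -- `X`. Subtracting the constant `F x` changes no derivative and makes the boundary term match the
  -- estimator.
  obtain ⟨G, hG, hGeq⟩ := hLip.extend_real
  have hle : ∀ w : E d, ‖w‖ < 1 →
      F (x + μ • w) - F (z + μ • w) ≤ μ⁻¹ * lineDeriv ℝ G w (x - z) := by
    intro w hw
    have hd : DifferentiableAt ℝ F (x + μ • w) :=
      hdiff.differentiableAt (isOpen_thickening.mem_nhds (add_smul_mem_thickening hμ hx hw))
    have hev : G =ᶠ[nhds w] fun w => F (x + μ • w) - F x := by
      filter_upwards [isOpen_ball.mem_nhds (show w ∈ ball (0 : E d) 1 by simpa using hw)] with a ha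
      exact (hGeq (ball_subset_closedBall ha)).symm
    have hfd : HasFDerivAt (fun w => F (x + μ • w) - F x)
        ((fderiv ℝ F (x + μ • w)).comp (μ • ContinuousLinearMap.id ℝ (E d))) w :=
      (hd.hasFDerivAt.comp w (((hasFDerivAt_id w).const_smul μ).const_add x)).sub_const _
    have hld := (hfd.hasLineDerivAt (x - z)).lineDeriv
    rw [hev.lineDeriv_eq, hld]
    have := sub_le_fderiv_of_convexOn hconv (hmaps x hx (by simpa using hw.le))
      (hmaps z hz (by simpa using hw.le)) hd
    simpa [hμ.ne'] using this
  have hGint : Integrable (fun w => μ⁻¹ * lineDeriv ℝ G w (x - z)) (unifBall d) := by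
    refine Integrable.const_mul ?_ _
    exact Integrable.of_bound (measurable_lineDeriv hG.continuous).aestronglyMeasurable _
      (Filter.Eventually.of_forall fun w => norm_lineDeriv_le_of_lipschitz ℝ hG)
  rw [← integral_sub (hint x hx) (hint z hz)]
  calc _ ≤ ∫ w, μ⁻¹ * lineDeriv ℝ G w (x - z) ∂unifBall d := by
        refine integral_mono_ae ((hint x hx).sub (hint z hz)) hGint ?_
        filter_upwards [ae_norm_lt_one_unifBall] with w hw using hle w hw
    _ = _ := by
        -- The factor `d` is the ratio of sphere area to ball volume; `μ⁻¹` comes from the chain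
        -- rule.
        have hd0 : (d : ℝ) ≠ 0 := NeZero.ne _
        rw [integral_const_mul, integral_unifBall,
          setIntegral_ball_lineDeriv_eq_integral_toSphere volume hG, integral_unifSphere,
          ← integral_const_mul, ← integral_const_mul, ← integral_const_mul]
        refine integral_congr_ae (Filter.Eventually.of_forall fun θ => ?_)
        have : G θ = F (x + μ • (θ : E d)) - F x := (hGeq (by simp)).symm
        simp only [this]
        field_simp

end Smoothing

/-! ### Optimality and continuity of the weighted projection. -/

section WeightedProjection

open Filter Topology

variable {d : ℕ} {X : Set (E d)}

theorem weightedProj_mem_and_isMinOn (hX : IsCompact X) (hne : X.Nonempty) (v y : E d) :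
    weightedProj X v y ∈ X ∧
      IsMinOn (fun w => weightedSqNorm v (w - y)) X (weightedProj X v y) := by
  have hc : Continuous fun w : E d => weightedSqNorm v (w - y) := by
    unfold weightedSqNorm
    fun_prop
  obtain ⟨z, hz, hmin⟩ := hX.exists_isMinOn hne hc.continuousOn
  exact Classical.epsilon_spec
    (p := fun z => z ∈ X ∧ IsMinOn (fun w => weightedSqNorm v (w - y)) X z) ⟨z, hz, hmin⟩

/-- First-order optimality of the weighted projection. -/
theorem weightedProj_variational (hX : IsCompact X) (hXc : Convex ℝ X) (v y : E d) {w : E d}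
    (hw : w ∈ X) :
    0 ≤ ∑ i, v i * (weightedProj X v y i - y i) * (w i - weightedProj X v y i) := by
  obtain ⟨hz, hmin⟩ := weightedProj_mem_and_isMinOn hX ⟨w, hw⟩ v y
  set z := weightedProj X v y
  set B := ∑ i, v i * (z i - y i) * (w i - z i)
  set C := weightedSqNorm v (w - z)
  have hexp : ∀ t : ℝ, weightedSqNorm v (z + t • (w - z) - y) =
      weightedSqNorm v (z - y) + 2 * t * B + t ^ 2 * C := by
    intro t
    simp only [weightedSqNorm, B, C, Finset.mul_sum, ← Finset.sum_add_distrib]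
    refine Finset.sum_congr rfl fun i _ => ?_
    simp
    ring
  -- Move the minimizer towards `w` by a fraction `t`, divide the increment by `t`, and let `t` tend
  -- to zero.
  have hineq : ∀ t ∈ Set.Ioc (0 : ℝ) 1, 0 ≤ 2 * B + t * C := by
    intro t ht
    have hmem : z + t • (w - z) ∈ X := hXc.add_smul_sub_mem hz hw ⟨ht.1.le, ht.2⟩
    have h1 : weightedSqNorm v (z - y) ≤ weightedSqNorm v (z + t • (w - z) - y) := hmin hmem
    rw [hexp] at h1
    have h2 : 0 ≤ t * (2 * B + t * C) := by linarith
    exact nonneg_of_mul_nonneg_right h2 ht.1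
  have hlim : Tendsto (fun t : ℝ => 2 * B + t * C) (𝓝[>] 0) (𝓝 (2 * B + 0 * C)) :=
    (Continuous.tendsto (by fun_prop) 0).mono_left nhdsWithin_le_nhds
  have h3 := ge_of_tendsto hlim (by
    filter_upwards [Ioc_mem_nhdsGT (zero_lt_one (α := ℝ))] with t ht using hineq t ht)
  linarith

/-- Test the optimality condition of each projection at the other one and add. The bound is small
when both weights and targets are close, which yields joint continuity. -/
theorem sum_mul_sq_weightedProj_sub_le (hX : IsCompact X) (hXc : Convex ℝ X) (hne : X.Nonempty)
    (v y v' y' : E d) :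
    ∑ i, v i * (weightedProj X v' y' i - weightedProj X v y i) ^ 2 ≤
      ∑ i, (weightedProj X v' y' i - weightedProj X v y i) *
        ((v i - v' i) * weightedProj X v' y' i - v i * y i + v' i * y' i) := by
  have h1 := weightedProj_variational hX hXc v y (weightedProj_mem_and_isMinOn hX hne v' y').1
  have h2 := weightedProj_variational hX hXc v' y' (weightedProj_mem_and_isMinOn hX hne v y).1
  rw [← sub_nonneg]
  refine (add_nonneg h1 h2).trans (le_of_eq ?_)
  rw [← Finset.sum_add_distrib, ← Finset.sum_sub_distrib]
  refine Finset.sum_congr rfl fun i _ => ?_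
  ring

theorem continuousOn_weightedProj (hX : IsCompact X) (hXc : Convex ℝ X) (hne : X.Nonempty) :
    ContinuousOn (fun q : E d × E d => weightedProj X q.1 q.2) {q | ∀ i, 0 < q.1 i} := by
  rintro ⟨v, y⟩ hv
  refine ContinuousAt.continuousWithinAt ?_
  obtain ⟨R, hR⟩ := hX.isBounded.exists_norm_le
  have hcoord : ∀ (q : E d × E d) (i : Fin d), |weightedProj X q.1 q.2 i| ≤ R := fun q i =>
    (PiLp.norm_apply_le _ i).trans (hR _ (weightedProj_mem_and_isMinOn hX hne _ _).1)
  set b : E d × E d → ℝ := fun q =>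
    ∑ i, 2 * R * (|v i - q.1 i| * R + |q.1 i * q.2 i - v i * y i|)
  have hb : Tendsto b (𝓝 (v, y)) (𝓝 0) := by
    have : Continuous b := by fun_prop
    have h := this.tendsto (v, y)
    simpa [b] using h
  have hle : ∀ q, ∑ i, v i * (weightedProj X q.1 q.2 i - weightedProj X v y i) ^ 2 ≤ b q := by
    intro q
    refine (sum_mul_sq_weightedProj_sub_le hX hXc hne v y q.1 q.2).trans
      (Finset.sum_le_sum fun i _ => ?_)
    have h1 := hcoord q i
    have h2 := hcoord (v, y) i
    have hR0 : 0 ≤ R := (abs_nonneg _).trans h1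
    refine (le_abs_self _).trans ?_
    rw [abs_mul]
    refine mul_le_mul ?_ ?_ (abs_nonneg _) (by positivity)
    · exact (abs_sub _ _).trans (by simp only at h2; linarith)
    · calc _ = |(v i - q.1 i) * weightedProj X q.1 q.2 i + (q.1 i * q.2 i - v i * y i)| := by
            congr 1; ring
        _ ≤ _ := by
          refine (abs_add_le _ _).trans ?_
          rw [abs_mul]
          gcongr
  have hsq : ∀ i, Tendsto (fun q : E d × E d =>
      (weightedProj X q.1 q.2 i - weightedProj X v y i) ^ 2) (𝓝 (v, y)) (𝓝 0) := by
    intro i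
    refine squeeze_zero (fun _ => sq_nonneg _) (g := fun q => b q / v i) (fun q => ?_) ?_
    · rw [le_div_iff₀ (hv i), mul_comm]
      refine le_trans ?_ (hle q)
      exact Finset.single_le_sum (f := fun i => v i * (weightedProj X q.1 q.2 i -
        weightedProj X v y i) ^ 2) (fun j _ => mul_nonneg (hv j).le (sq_nonneg _))
        (Finset.mem_univ i)
    · simpa using hb.div_const (v i)
  rw [ContinuousAt, tendsto_iff_norm_sub_tendsto_zero]
  have hsum := tendsto_finsetSum Finset.univ fun i _ => hsq i
  have := (Real.continuous_sqrt.tendsto _).comp hsum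
  simp only [Finset.sum_const_zero, Real.sqrt_zero] at this
  refine this.congr fun q => ?_
  simp [EuclideanSpace.norm_eq]

end WeightedProjection

/-! ### Deterministic estimates for momentum and for one projected step. -/

section Regret

variable {d : ℕ} {X : Set (E d)}

/-- In closed form this is Cauchy–Schwarz, `(∑ β₁^(t-s) |g_s|)² ≤ (∑ γ^(t-s)) (∑ β₂^(t-s) g_s²)`
with `γ = β₁²/β₂`. The induction step is a perfect square divided by `β₂`. -/
theorem sq_le_of_recursion {β₁ β₂ : ℝ} (hβ₂ : 0 < β₂) {A V g : ℕ → ℝ} (hA0 : A 0 = 0) (hA : ∀ t, A (t + 1) = β₁ * A t + |g (t + 1)|)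
    (hV0 : V 0 = 0) (hV : ∀ t, V (t + 1) = β₂ * V t + (1 - β₂) * g (t + 1) ^ 2)
    (hβ₂1 : β₂ < 1) (t : ℕ) :
    (1 - β₂) * (1 - β₁ ^ 2 / β₂) * A t ^ 2 ≤ V t := by
  induction t with
  | zero => simp [hA0, hV0]
  | succ t ih =>
    rw [hA, hV]
    set γ := β₁ ^ 2 / β₂ with hγd
    have hγβ : β₁ ^ 2 = γ * β₂ := by rw [hγd]; field_simp
    set G := |g (t + 1)|
    have hG : g (t + 1) ^ 2 = G ^ 2 := (sq_abs _).symm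
    rw [hG]
    have h1 : (1 - γ) * (β₁ * A t + G) ^ 2 ≤ β₂ * ((1 - γ) * A t ^ 2) + G ^ 2 := by
      have h2 : 0 ≤ ((1 - γ) * β₂ * A t - β₁ * G) ^ 2 := sq_nonneg _
      have h3 : ((1 - γ) * β₂ * A t - β₁ * G) ^ 2 =
          β₂ * (β₂ * ((1 - γ) * A t ^ 2) + G ^ 2 - (1 - γ) * (β₁ * A t + G) ^ 2) := by
        have : ((1 - γ) * β₂ * A t - β₁ * G) ^ 2 = (1 - γ) ^ 2 * β₂ ^ 2 * A t ^ 2 -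
          2 * (1 - γ) * β₂ * A t * β₁ * G + β₁ ^ 2 * G ^ 2 := by ring
        rw [this]
        have : (β₁ * A t + G) ^ 2 = β₁ ^ 2 * A t ^ 2 + 2 * β₁ * A t * G + G ^ 2 := by ring
        rw [this, hγβ]
        ring
      rw [h3] at h2
      have := nonneg_of_mul_nonneg_right h2 hβ₂
      linarith
    calc _ = (1 - β₂) * ((1 - γ) * (β₁ * A t + G) ^ 2) := by ring
      _ ≤ (1 - β₂) * (β₂ * ((1 - γ) * A t ^ 2) + G ^ 2) := by
          gcongr
      _ = β₂ * ((1 - β₂) * (1 - γ) * A t ^ 2) + (1 - β₂) * G ^ 2 := by ring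
      _ ≤ _ := by gcongr

theorem sum_abs_div_sqrt_le (g : ℕ → ℝ) (T : ℕ) :
    ∑ t ∈ Finset.Icc 1 T, |g t| / √(t : ℝ) ≤
      √(1 + Real.log T) * √(∑ t ∈ Finset.Icc 1 T, g t ^ 2) := by
  have h1 := Real.sum_mul_le_sqrt_mul_sqrt (Finset.Icc 1 T) (fun t : ℕ => 1 / √(t : ℝ))
    (fun t => |g t|)
  have h2 : ∑ t ∈ Finset.Icc 1 T, (1 / √(t : ℝ)) ^ 2 ≤ 1 + Real.log T := by
    refine le_trans (le_of_eq ?_) (harmonic_le_one_add_log T)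
    rw [harmonic_eq_sum_Icc]
    push_cast
    refine Finset.sum_congr rfl fun t _ => ?_
    rw [div_pow, Real.sq_sqrt (Nat.cast_nonneg _), one_pow, one_div]
  calc _ = ∑ t ∈ Finset.Icc 1 T, 1 / √(t : ℝ) * |g t| :=
        Finset.sum_congr rfl fun t _ => by ring
    _ ≤ _ := h1
    _ ≤ _ := by
      simp only [sq_abs]
      gcongr

/-- Since `1/√t` decreases, exchanging sums would give a geometric factor `1/(1-β)`. The extra term
with `A T` carries the unspent mass through the induction; at `T = 0` it is zero because `A 0 = 0`.
-/
theorem sum_recursion_div_sqrt_le {β : ℝ} (hβ : 0 ≤ β) {A g : ℕ → ℝ}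
    (hA0 : A 0 = 0) (hA : ∀ t, A (t + 1) = β * A t + |g (t + 1)|) (T : ℕ) :
    (1 - β) * ∑ t ∈ Finset.Icc 1 T, A t / √(t : ℝ) + β * (A T / √(T : ℝ)) ≤
      ∑ t ∈ Finset.Icc 1 T, |g t| / √(t : ℝ) := by
  have hAnn : ∀ t, 0 ≤ A t := by
    intro t
    induction t with
    | zero => simp [hA0]
    | succ t ih => rw [hA]; positivity
  induction T with
  | zero => simp
  | succ T ih =>
    rw [Finset.sum_Icc_succ_top (by omega), Finset.sum_Icc_succ_top (by omega)]
    have h1 : A T / √((T + 1 : ℕ) : ℝ) ≤ A T / √(T : ℝ) := by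
      rcases Nat.eq_zero_or_pos T with rfl | hT
      · simp [hA0]
      · have := hAnn T
        have : 0 < √(T : ℝ) := by positivity
        gcongr
        omega
    have h2 : A (T + 1) / √((T + 1 : ℕ) : ℝ) =
        β * (A T / √((T + 1 : ℕ) : ℝ)) + |g (T + 1)| / √((T + 1 : ℕ) : ℝ) := by
      rw [hA]; ring
    have h3 := mul_le_mul_of_nonneg_left h1 hβ
    linarith

/-- The accumulated squared momentum of one coordinate, in the adaptive norm. -/
theorem sum_momentum_sq_le {α β₁ β₂ : ℝ} (hα : 0 < α) (hβ₁ : 0 ≤ β₁) (hβ₁1 : β₁ < 1)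
    (hβ₂ : 0 < β₂) (hβ₂1 : β₂ < 1) (hγ : β₁ ^ 2 / β₂ < 1) {m v vh g : ℕ → ℝ}
    (hm0 : m 0 = 0) (hm : ∀ t, m (t + 1) = β₁ * m t + (1 - β₁) * g (t + 1))
    (hv0 : v 0 = 0) (hv : ∀ t, v (t + 1) = β₂ * v t + (1 - β₂) * g (t + 1) ^ 2)
    (hvh : ∀ t, 0 < vh t) (hvvh : ∀ t, v t ≤ vh t) (T : ℕ) :
    ∑ t ∈ Finset.Icc 1 T, α / √(t : ℝ) * (m t ^ 2 / √(vh t)) ≤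
      (1 - β₁) * (α * √(1 + Real.log T) / √((1 - β₂) * (1 - β₁ ^ 2 / β₂))) *
        √(∑ t ∈ Finset.Icc 1 T, g t ^ 2) := by
  -- `A t` is the undamped average `∑ β₁^(t-s) |g s|`. It controls `|m t|` from above and `√(vh t)`
  -- from below, so one power of it cancels in the quotient.
  obtain ⟨A, hA0, hA⟩ : ∃ A : ℕ → ℝ, A 0 = 0 ∧ ∀ t, A (t + 1) = β₁ * A t + |g (t + 1)| :=
    ⟨fun t => Nat.rec 0 (fun t a => β₁ * a + |g (t + 1)|) t, rfl, fun _ => rfl⟩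
  have hAnn : ∀ t, 0 ≤ A t := by
    intro t
    induction t with
    | zero => simp [hA0]
    | succ t ih => rw [hA]; positivity
  have hmA : ∀ t, |m t| ≤ (1 - β₁) * A t := by
    intro t
    induction t with
    | zero => simp [hm0, hA0]
    | succ t ih =>
      rw [hm, hA]
      refine (abs_add_le _ _).trans ?_
      rw [abs_mul, abs_mul, abs_of_nonneg hβ₁, abs_of_nonneg (by linarith : 0 ≤ 1 - β₁)]
      nlinarith [mul_le_mul_of_nonneg_left ih hβ₁]
  set κ := (1 - β₂) * (1 - β₁ ^ 2 / β₂) with hκ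
  have hκ0 : 0 < κ := mul_pos (by linarith) (by linarith)
  have hAs : ∀ t, √κ * A t ≤ √(vh t) := by
    intro t
    have h1 := sq_le_of_recursion hβ₂ hA0 hA hv0 hv hβ₂1 t
    rw [← Real.sqrt_sq (hAnn t), ← Real.sqrt_mul hκ0.le]
    exact Real.sqrt_le_sqrt (h1.trans (hvvh t))
  have hterm : ∀ t, m t ^ 2 / √(vh t) ≤ (1 - β₁) ^ 2 / √κ * A t := by
    intro t
    have hs : 0 < √(vh t) := Real.sqrt_pos.2 (hvh t)
    have hk : 0 < √κ := Real.sqrt_pos.2 hκ0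
    have h1 : m t ^ 2 ≤ ((1 - β₁) * A t) ^ 2 := by
      rw [← sq_abs]
      exact pow_le_pow_left₀ (abs_nonneg _) (hmA t) 2
    rw [div_le_iff₀ hs]
    calc m t ^ 2 ≤ ((1 - β₁) * A t) ^ 2 := h1
      _ = (1 - β₁) ^ 2 / √κ * A t * (√κ * A t) := by field_simp
      _ ≤ _ := by
        have := hAnn t
        exact mul_le_mul_of_nonneg_left (hAs t) (by positivity)
  have hsum := sum_recursion_div_sqrt_le hβ₁ hA0 hA T
  have hcs := sum_abs_div_sqrt_le g T
  have hlast : 0 ≤ β₁ * (A T / √(T : ℝ)) := by have := hAnn T; positivity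
  have hk : 0 < √κ := Real.sqrt_pos.2 hκ0
  calc _ ≤ ∑ t ∈ Finset.Icc 1 T, α / √(t : ℝ) * ((1 - β₁) ^ 2 / √κ * A t) := by
        gcongr with t _
        exact hterm t
    _ = (α * (1 - β₁) / √κ) * ((1 - β₁) * ∑ t ∈ Finset.Icc 1 T, A t / √(t : ℝ)) := by
        rw [Finset.mul_sum, Finset.mul_sum]
        exact Finset.sum_congr rfl fun t _ => by ring
    _ ≤ (α * (1 - β₁) / √κ) *
        (√(1 + Real.log T) * √(∑ t ∈ Finset.Icc 1 T, g t ^ 2)) := by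
        have : 0 ≤ 1 - β₁ := by linarith
        exact mul_le_mul_of_nonneg_left (by linarith) (by positivity)
    _ = _ := by ring

/-- Coordinatewise, the right side minus the left side minus the optimality expression at `w` is
half of a weighted perfect square. -/
theorem amsgradStep_inner_le (p : Params) (hX : IsCompact X) (hXc : Convex ℝ X)
    (t : ℕ) (g : E d) (S : State d) (hpos : ∀ i, 0 < (amsgradStep p X t g S).vhat i)
    {w : E d} (hw : w ∈ X) :
    p.α / √(t : ℝ) * ∑ i, (amsgradStep p X t g S).m i * (S.x i - w i) ≤
      1 / 2 * ∑ i, √((amsgradStep p X t g S).vhat i) *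
          ((S.x i - w i) ^ 2 - ((amsgradStep p X t g S).x i - w i) ^ 2) +
        1 / 2 * (p.α / √(t : ℝ)) ^ 2 *
          ∑ i, (amsgradStep p X t g S).m i ^ 2 / √((amsgradStep p X t g S).vhat i) := by
  set S' := amsgradStep p X t g S with hS'
  have hvar : 0 ≤ ∑ i, √(S'.vhat i) *
      (S'.x i - (S.x i - p.α / √(t : ℝ) * (S'.m i / √(S'.vhat i)))) * (w i - S'.x i) :=
    weightedProj_variational hX hXc (WithLp.toLp 2 fun i => √(S'.vhat i))
      (WithLp.toLp 2 fun i => S.x i - p.α / √(t : ℝ) * (S'.m i / √(S'.vhat i))) hw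
  clear_value S'
  rw [← sub_nonneg]
  refine hvar.trans ?_
  simp only [Finset.mul_sum]
  rw [← Finset.sum_add_distrib, ← Finset.sum_sub_distrib]
  refine Finset.sum_le_sum fun i _ => ?_
  have hs : 0 < √(S'.vhat i) := Real.sqrt_pos.2 (hpos i)
  set s := √(S'.vhat i)
  set a := p.α / √(t : ℝ)
  have h1 : 0 ≤ 1 / 2 * s * ((S.x i - S'.x i) - a * (S'.m i / s)) ^ 2 := by positivity
  rw [← sub_nonneg]
  refine h1.trans (le_of_eq ?_)
  field_simp
  ring

/-- Optimality tested at the previous iterate controls how far one step moves along the momentum;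
this pays for the mismatch between `m_t` and `x_{t+1}`. -/
theorem amsgradStep_inner_sub_le (p : Params) (hX : IsCompact X) (hXc : Convex ℝ X)
    (t : ℕ) (g : E d) (S : State d) (hpos : ∀ i, 0 < (amsgradStep p X t g S).vhat i)
    (hx : S.x ∈ X) :
    p.α / √(t : ℝ) * ∑ i, (amsgradStep p X t g S).m i * (S.x i - (amsgradStep p X t g S).x i) ≤
      (p.α / √(t : ℝ)) ^ 2 *
          ∑ i, (amsgradStep p X t g S).m i ^ 2 / √((amsgradStep p X t g S).vhat i) := by
  set S' := amsgradStep p X t g S with hS'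
  have hvar : 0 ≤ ∑ i, √(S'.vhat i) *
      (S'.x i - (S.x i - p.α / √(t : ℝ) * (S'.m i / √(S'.vhat i)))) * (S.x i - S'.x i) :=
    weightedProj_variational hX hXc (WithLp.toLp 2 fun i => √(S'.vhat i))
      (WithLp.toLp 2 fun i => S.x i - p.α / √(t : ℝ) * (S'.m i / √(S'.vhat i))) hx
  clear_value S'
  rw [← sub_nonneg]
  refine hvar.trans ?_
  simp only [Finset.mul_sum]
  rw [← Finset.sum_sub_distrib]
  refine Finset.sum_le_sum fun i _ => ?_
  have hs : 0 < √(S'.vhat i) := Real.sqrt_pos.2 (hpos i)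
  set s := √(S'.vhat i)
  set a := p.α / √(t : ℝ)
  have h1 : 0 ≤ s * ((S.x i - S'.x i) - a * (S'.m i / s)) ^ 2 := by positivity
  rw [← sub_nonneg]
  refine h1.trans (le_of_eq ?_)
  field_simp
  ring

end Regret

/-! ### Pathwise regret of AMSGrad. -/

section AMSGrad

variable {d : ℕ} {X : Set (E d)} {p : Params} {S : ℕ → State d} {g : ℕ → E d}

theorem abs_sub_le_supDiam (hX : IsCompact X) {x y : E d} (hx : x ∈ X) (hy : y ∈ X) (i : Fin d) :
    |x i - y i| ≤ supDiam X := by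
  have hb : Bornology.IsBounded ((fun x : E d => (WithLp.ofLp x : Fin d → ℝ)) '' X) :=
    (hX.image (by fun_prop)).isBounded
  have h1 := Metric.dist_le_diam_of_mem hb (Set.mem_image_of_mem _ hx) (Set.mem_image_of_mem _ hy)
  exact (dist_le_pi_dist (WithLp.ofLp x) (WithLp.ofLp y) i).trans h1

theorem amsgrad_x_mem (hX : IsCompact X) (hx₀ : (S 0).x ∈ X)
    (hS : ∀ t, S (t + 1) = amsgradStep p X (t + 1) (g (t + 1)) (S t)) (t : ℕ) : (S t).x ∈ X := by
  cases t with
  | zero => exact hx₀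
  | succ t => rw [hS]; exact (weightedProj_mem_and_isMinOn hX ⟨_, hx₀⟩ _ _).1

theorem amsgrad_vhat_le_succ
    (hS : ∀ t, S (t + 1) = amsgradStep p X (t + 1) (g (t + 1)) (S t)) (t : ℕ) (i : Fin d) :
    (S t).vhat i ≤ (S (t + 1)).vhat i := by
  rw [hS]; exact le_max_left _ _

theorem amsgrad_le_vhat (hε : ∀ i, (S 0).vhat i = p.ε)
    (hS : ∀ t, S (t + 1) = amsgradStep p X (t + 1) (g (t + 1)) (S t)) (t : ℕ) (i : Fin d) :
    p.ε ≤ (S t).vhat i := by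
  induction t with
  | zero => exact (hε i).ge
  | succ t ih => exact ih.trans (amsgrad_vhat_le_succ hS t i)

theorem amsgrad_v_le_vhat (hε0 : 0 < p.ε) (hv₀ : (S 0).v = 0) (hε : ∀ i, (S 0).vhat i = p.ε)
    (hS : ∀ t, S (t + 1) = amsgradStep p X (t + 1) (g (t + 1)) (S t)) (t : ℕ) (i : Fin d) :
    (S t).v i ≤ (S t).vhat i := by
  cases t with
  | zero => simp [hv₀, hε, hε0.le]
  | succ t => rw [hS]; exact le_max_right _ _

/-- The potential argument behind the regret bound for a constant momentum parameter. -/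
theorem amsgrad_sum_inner_le_potential (hα : 0 < p.α) (hβ₁0 : 0 ≤ p.β₁) (hβ₁ : p.β₁ < 1)
    (hε0 : 0 < p.ε) (hX : IsCompact X) (hXc : Convex ℝ X) (hx₀ : (S 0).x ∈ X) (hm₀ : (S 0).m = 0)
    (hε : ∀ i, (S 0).vhat i = p.ε)
    (hS : ∀ t, S (t + 1) = amsgradStep p X (t + 1) (g (t + 1)) (S t)) {w : E d} (hw : w ∈ X)
    (T : ℕ) :
    ∑ t ∈ Finset.Icc 1 T, ∑ i, g t i * ((S (t - 1)).x i - w i) ≤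
      p.β₁ / (1 - p.β₁) * ∑ i, (S T).m i * ((S (T - 1)).x i - w i) +
      √(T : ℝ) / (2 * p.α) *
        ∑ i, √((S T).vhat i) * (supDiam X ^ 2 - ((S T).x i - w i) ^ 2) +
      (1 / 2 + p.β₁ / (1 - p.β₁)) * ∑ t ∈ Finset.Icc 1 T,
        p.α / √(t : ℝ) * ∑ i, (S t).m i ^ 2 / √((S t).vhat i) -
      p.β₁ / (1 - p.β₁) * (p.α / √(T : ℝ) * ∑ i, (S T).m i ^ 2 / √((S T).vhat i)) := by
  have h1β : 0 < 1 - p.β₁ := by linarith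
  set c := p.β₁ / (1 - p.β₁) with hc
  have hc0 : 0 ≤ c := by positivity
  have hpos : ∀ t i, 0 < (S t).vhat i := fun t i => hε0.trans_le (amsgrad_le_vhat hε hS t i)
  have hmem := amsgrad_x_mem hX hx₀ hS
  -- `(S (t - 1)).x` is `x_t` and `(S t).x` is `x_{t+1}`. At `t = 0` truncated subtraction is
  -- harmless since `m_0 = 0`.
  have hdrift : ∀ t, ∑ i, (S t).m i * ((S (t - 1)).x i - (S t).x i) ≤
      p.α / √(t : ℝ) * ∑ i, (S t).m i ^ 2 / √((S t).vhat i) := by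
    intro t
    cases t with
    | zero => simp [hm₀]
    | succ t =>
      have h := amsgradStep_inner_sub_le p hX hXc (t + 1) (g (t + 1)) (S t)
        (by rw [← hS]; exact hpos _) (hmem t)
      rw [← hS, sq, mul_assoc] at h
      exact le_of_mul_le_mul_left h (by positivity)
  have hstep : ∀ t, ∑ i, (S (t + 1)).m i * ((S t).x i - w i) ≤
      √((t + 1 : ℕ) : ℝ) / (2 * p.α) * ∑ i, √((S (t + 1)).vhat i) *
        (((S t).x i - w i) ^ 2 - ((S (t + 1)).x i - w i) ^ 2) +
      1 / 2 * (p.α / √((t + 1 : ℕ) : ℝ) *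
        ∑ i, (S (t + 1)).m i ^ 2 / √((S (t + 1)).vhat i)) := by
    intro t
    have h := amsgradStep_inner_le p hX hXc (t + 1) (g (t + 1)) (S t)
      (by rw [← hS]; exact hpos _) hw
    rw [← hS] at h
    have ha : 0 < p.α / √((t + 1 : ℕ) : ℝ) := by positivity
    refine le_of_mul_le_mul_left (h.trans (le_of_eq ?_)) ha
    have : √((t + 1 : ℕ) : ℝ) ≠ 0 := by positivity
    field_simp
  induction T with
  | zero => simp [hm₀]
  | succ T ih =>
    rw [Finset.sum_Icc_succ_top (by omega), Finset.sum_Icc_succ_top (by omega), Nat.add_sub_cancel]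
    -- Inverts the momentum recursion: `1 + c = 1/(1 - β₁)`.
    have hg : ∑ i, g (T + 1) i * ((S T).x i - w i) =
        (1 + c) * ∑ i, (S (T + 1)).m i * ((S T).x i - w i) -
          c * ∑ i, (S T).m i * ((S T).x i - w i) := by
      rw [Finset.mul_sum, Finset.mul_sum, ← Finset.sum_sub_distrib]
      refine Finset.sum_congr rfl fun i _ => ?_
      have : (S (T + 1)).m i = p.β₁ * (S T).m i + (1 - p.β₁) * g (T + 1) i := by
        rw [hS]; simp [amsgradStep]
      rw [this, hc]
      field_simp
      ring
    have hsplit : ∑ i, (S T).m i * ((S (T - 1)).x i - w i) -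
        ∑ i, (S T).m i * ((S T).x i - w i) =
          ∑ i, (S T).m i * ((S (T - 1)).x i - (S T).x i) := by
      rw [← Finset.sum_sub_distrib]
      exact Finset.sum_congr rfl fun i _ => by ring
    have hd := mul_le_mul_of_nonneg_left (hdrift T) hc0
    rw [← hsplit] at hd
    -- Measuring the deficit from the squared diameter keeps every coefficient nonnegative, so
    -- increasing the weights `√T` and `√v̂` can only increase the potential.
    have hW : √(T : ℝ) / (2 * p.α) *
          ∑ i, √((S T).vhat i) * (supDiam X ^ 2 - ((S T).x i - w i) ^ 2) ≤
        √((T + 1 : ℕ) : ℝ) / (2 * p.α) *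
          ∑ i, √((S (T + 1)).vhat i) * (supDiam X ^ 2 - ((S T).x i - w i) ^ 2) := by
      have hnn : ∀ i, 0 ≤ supDiam X ^ 2 - ((S T).x i - w i) ^ 2 := fun i => by
        rw [sub_nonneg, ← sq_abs ((S T).x i - w i)]
        exact pow_le_pow_left₀ (abs_nonneg _) (abs_sub_le_supDiam hX (hmem T) hw i) 2
      have hvm := amsgrad_vhat_le_succ hS T
      refine mul_le_mul ?_ ?_ ?_ (by positivity)
      · gcongr
        omega
      · exact Finset.sum_le_sum fun i _ =>
          mul_le_mul_of_nonneg_right (Real.sqrt_le_sqrt (hvm i)) (hnn i)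
      · exact Finset.sum_nonneg fun i _ => mul_nonneg (Real.sqrt_nonneg _) (hnn i)
    have hsum : ∑ i, √((S (T + 1)).vhat i) *
          (((S T).x i - w i) ^ 2 - ((S (T + 1)).x i - w i) ^ 2) =
        ∑ i, √((S (T + 1)).vhat i) * (supDiam X ^ 2 - ((S (T + 1)).x i - w i) ^ 2) -
        ∑ i, √((S (T + 1)).vhat i) * (supDiam X ^ 2 - ((S T).x i - w i) ^ 2) := by
      rw [← Finset.sum_sub_distrib]
      exact Finset.sum_congr rfl fun i _ => by ring
    have hs := hstep T
    rw [hsum] at hs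
    rw [hg]
    linarith

/-- Pathwise regret bound for AMSGrad with a constant momentum parameter. -/
theorem amsgrad_sum_inner_le (hα : 0 < p.α) (hβ₁0 : 0 ≤ p.β₁) (hβ₁ : p.β₁ < 1)
    (hβ₂0 : 0 < p.β₂) (hβ₂ : p.β₂ < 1) (hγ : p.β₁ ^ 2 / p.β₂ < 1)
    (hε0 : 0 < p.ε) (hX : IsCompact X) (hXc : Convex ℝ X) (hx₀ : (S 0).x ∈ X) (hm₀ : (S 0).m = 0)
    (hv₀ : (S 0).v = 0) (hε : ∀ i, (S 0).vhat i = p.ε)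
    (hS : ∀ t, S (t + 1) = amsgradStep p X (t + 1) (g (t + 1)) (S t)) {w : E d} (hw : w ∈ X)
    {T : ℕ} (hT : 1 ≤ T) :
    ∑ t ∈ Finset.Icc 1 T, ∑ i, g t i * ((S (t - 1)).x i - w i) ≤
      supDiam X ^ 2 * √(T : ℝ) / (2 * p.α * (1 - p.β₁)) * ∑ i, √((S T).vhat i) +
      p.α * √(1 + Real.log T) / √((1 - p.β₂) * (1 - p.β₁ ^ 2 / p.β₂)) *
        ∑ i, √(∑ t ∈ Finset.Icc 1 T, g t i ^ 2) := by
  have h1β : 0 < 1 - p.β₁ := by linarith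
  have hpot := amsgrad_sum_inner_le_potential hα hβ₁0 hβ₁ hε0 hX hXc hx₀ hm₀ hε hS hw T
  have hpos : ∀ t i, 0 < (S t).vhat i := fun t i => hε0.trans_le (amsgrad_le_vhat hε hS t i)
  have hmem := amsgrad_x_mem hX hx₀ hS
  set D := supDiam X
  set M : ℕ → ℝ := fun t => p.α / √(t : ℝ) * ∑ i, (S t).m i ^ 2 / √((S t).vhat i) with hM
  set N := ∑ i, √((S T).vhat i)
  set Q := ∑ i, √(∑ t ∈ Finset.Icc 1 T, g t i ^ 2)
  set C := p.α * √(1 + Real.log T) / √((1 - p.β₂) * (1 - p.β₁ ^ 2 / p.β₂))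
  set c := p.β₁ / (1 - p.β₁) with hc
  have hc0 : 0 ≤ c := by positivity
  have hMsum : ∑ t ∈ Finset.Icc 1 T, M t ≤ (1 - p.β₁) * C * Q := by
    simp only [hM, Q, Finset.mul_sum]
    rw [Finset.sum_comm]
    refine Finset.sum_le_sum fun i _ => ?_
    refine sum_momentum_sq_le hα hβ₁0 hβ₁ hβ₂0 hβ₂ hγ (m := fun t => (S t).m i)
      (v := fun t => (S t).v i) (vh := fun t => (S t).vhat i) (g := fun t => g t i)
      (by simp [hm₀]) (fun t => ?_) (by simp [hv₀]) (fun t => ?_) (fun t => hpos t i)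
      (fun t => amsgrad_v_le_vhat hε0 hv₀ hε hS t i) T
    · simp only [hS]; simp [amsgradStep]
    · simp only [hS]; simp [amsgradStep]
  -- Boundary term of the summation by parts. Its `M T` is absorbed by the negative term of the
  -- potential bound, as the drift sum stops at `T - 1`.
  have hlast : ∑ i, (S T).m i * ((S (T - 1)).x i - w i) ≤
      √(T : ℝ) / (2 * p.α) * (D ^ 2 * N) + M T := by
    obtain ⟨t, rfl⟩ : ∃ t, T = t + 1 := ⟨T - 1, by omega⟩
    have h := amsgradStep_inner_le p hX hXc (t + 1) (g (t + 1)) (S t)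
      (by rw [← hS]; exact hpos _) hw
    rw [← hS] at h
    have ha : 0 < p.α / √((t + 1 : ℕ) : ℝ) := by positivity
    have hs0 : √((t + 1 : ℕ) : ℝ) ≠ 0 := by positivity
    rw [Nat.add_sub_cancel]
    refine le_of_mul_le_mul_left (h.trans ?_) ha
    have h2 : ∑ i, √((S (t + 1)).vhat i) *
        (((S t).x i - w i) ^ 2 - ((S (t + 1)).x i - w i) ^ 2) ≤ D ^ 2 * N := by
      rw [Finset.mul_sum]
      refine Finset.sum_le_sum fun i _ => ?_
      rw [mul_comm]
      refine mul_le_mul_of_nonneg_right ?_ (Real.sqrt_nonneg _)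
      have : ((S t).x i - w i) ^ 2 ≤ D ^ 2 := by
        rw [← sq_abs ((S t).x i - w i)]
        exact pow_le_pow_left₀ (abs_nonneg _) (abs_sub_le_supDiam hX (hmem t) hw i) 2
      linarith [sq_nonneg ((S (t + 1)).x i - w i)]
    have h3 : 0 ≤ (p.α / √((t + 1 : ℕ) : ℝ)) ^ 2 *
        ∑ i, (S (t + 1)).m i ^ 2 / √((S (t + 1)).vhat i) := by
      have : 0 ≤ ∑ i, (S (t + 1)).m i ^ 2 / √((S (t + 1)).vhat i) :=
        Finset.sum_nonneg fun i _ => by positivity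
      positivity
    have h4 : p.α / √((t + 1 : ℕ) : ℝ) * (√((t + 1 : ℕ) : ℝ) / (2 * p.α) * (D ^ 2 * N) +
        M (t + 1)) = 1 / 2 * (D ^ 2 * N) + (p.α / √((t + 1 : ℕ) : ℝ)) ^ 2 *
        ∑ i, (S (t + 1)).m i ^ 2 / √((S (t + 1)).vhat i) := by
      simp only [hM]
      field_simp
    rw [h4]
    linarith
  have hW : √(T : ℝ) / (2 * p.α) *
        ∑ i, √((S T).vhat i) * (D ^ 2 - ((S T).x i - w i) ^ 2) ≤
      √(T : ℝ) / (2 * p.α) * (D ^ 2 * N) := by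
    refine mul_le_mul_of_nonneg_left ?_ (by positivity)
    rw [Finset.mul_sum]
    refine Finset.sum_le_sum fun i _ => ?_
    rw [mul_comm]
    exact mul_le_mul_of_nonneg_right (by linarith [sq_nonneg ((S T).x i - w i)])
      (Real.sqrt_nonneg _)
  have hCQ : 0 ≤ C * Q := by
    have : 0 ≤ Q := Finset.sum_nonneg fun i _ => Real.sqrt_nonneg _
    positivity
  -- The constant is `(1/2 + c)(1 - β₁) = (1 + β₁)/2 ≤ 1`.
  have hMT : (1 / 2 + c) * ∑ t ∈ Finset.Icc 1 T, M t ≤ C * Q := by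
    refine (mul_le_mul_of_nonneg_left hMsum (by positivity)).trans ?_
    have : (1 / 2 + c) * ((1 - p.β₁) * C * Q) = (1 + p.β₁) / 2 * (C * Q) := by
      rw [hc]; field_simp; ring
    rw [this]
    exact mul_le_of_le_one_left hCQ (by linarith)
  have hcl := mul_le_mul_of_nonneg_left hlast hc0
  have hfin : D ^ 2 * √(T : ℝ) / (2 * p.α * (1 - p.β₁)) * N =
      (1 + c) * (√(T : ℝ) / (2 * p.α) * (D ^ 2 * N)) := by
    rw [hc]; field_simp; ring
  rw [hfin]
  linarith

end AMSGrad

/-! ### Measurability of the iterates and independence from the fresh sample. -/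

section Measurability

variable {d : ℕ} {Ξ : Type*} {X : Set (E d)} {p : Params} {f : E d → Ξ → ℝ}

theorem run_le_vhat (p : Params) (X : Set (E d)) (f : E d → Ξ → ℝ) (x₁ : E d) (ξ : ℕ → Ξ)
    (u : ℕ → E d) (n : ℕ) (i : Fin d) : p.ε ≤ (run p X f x₁ ξ u n).vhat i :=
  amsgrad_le_vhat (p := p) (X := X) (S := run p X f x₁ ξ u) (g := gradEst p X f x₁ ξ u)
    (fun _ => rfl) (fun _ => rfl) n i

theorem run_x_mem (hX : IsCompact X) {x₁ : E d} (hx₁ : x₁ ∈ X) (ξ : ℕ → Ξ) (u : ℕ → E d) (n : ℕ) :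
    (run p X f x₁ ξ u n).x ∈ X :=
  amsgrad_x_mem (p := p) (S := run p X f x₁ ξ u) (g := gradEst p X f x₁ ξ u) hX hx₁
    (fun _ => rfl) n

variable [MeasurableSpace Ξ]

theorem measurable_zoGrad (hf : Measurable (Function.uncurry f)) (μ : ℝ) {Ω : Type*}
    [MeasurableSpace Ω] {x u : Ω → E d} {ξ : Ω → Ξ} (hx : Measurable x) (hξ : Measurable ξ)
    (hu : Measurable u) : Measurable fun ω => zoGrad f μ (x ω) (ξ ω) (u ω) := by
  have h1 : Measurable fun ω => f (x ω + μ • u ω) (ξ ω) :=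
    hf.comp ((hx.add (hu.const_smul μ)).prodMk hξ)
  have h2 : Measurable fun ω => f (x ω) (ξ ω) := hf.comp (hx.prodMk hξ)
  exact ((h1.sub h2).const_mul _).smul hu

theorem measurable_coord (i : Fin d) : Measurable fun x : E d => x i :=
  (EuclideanSpace.proj (𝕜 := ℝ) i).measurable

/-- Continuity is known only for positive weights. Clamping them below at `δ` gives a globally
continuous map that agrees with the projection on the given weights. -/
theorem measurable_weightedProj_of_le (hX : IsCompact X) (hXc : Convex ℝ X) (hne : X.Nonempty)
    {Ω : Type*} [MeasurableSpace Ω] {δ : ℝ} (hδ : 0 < δ) {v y : Ω → E d} (hv : Measurable v)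
    (hy : Measurable y) (hle : ∀ ω i, δ ≤ v ω i) :
    Measurable fun ω => weightedProj X (v ω) (y ω) := by
  have hc : Continuous fun q : E d × E d =>
      weightedProj X (WithLp.toLp 2 fun i => max δ (q.1 i)) q.2 := by
    refine (continuousOn_weightedProj hX hXc hne).comp_continuous
      (f := fun q : E d × E d => ((WithLp.toLp 2 fun i => max δ (q.1 i) : E d), q.2)) ?_ ?_
    · fun_prop
    · exact fun q i => hδ.trans_le (le_max_left _ _)
  have h := hc.measurable.comp (hv.prodMk hy)
  have heq : (fun ω => weightedProj X (v ω) (y ω)) = (fun q : E d × E d =>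
      weightedProj X (WithLp.toLp 2 fun i => max δ (q.1 i)) q.2) ∘ fun ω => (v ω, y ω) := by
    funext ω
    have : (WithLp.toLp 2 fun i => max δ (v ω i) : E d) = v ω := by
      ext i
      exact max_eq_right (hle ω i)
    simp [this]
  rw [heq]
  exact h

/-- The state after `n` steps is measurable with respect to the first `n` samples. -/
theorem measurable_run (hX : IsCompact X) (hXc : Convex ℝ X) (hε : 0 < p.ε)
    (hf : Measurable (Function.uncurry f)) {x₁ : E d} (hx₁ : x₁ ∈ X) {Ω : Type*}
    [MeasurableSpace Ω] {ξ : ℕ → Ω → Ξ} {u : ℕ → Ω → E d} (n : ℕ)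
    (hξ : ∀ t ∈ Finset.Icc 1 n, Measurable (ξ t)) (hu : ∀ t ∈ Finset.Icc 1 n, Measurable (u t)) :
    Measurable (fun ω => (run p X f x₁ (ξ · ω) (u · ω) n).x) ∧
    Measurable (fun ω => (run p X f x₁ (ξ · ω) (u · ω) n).m) ∧
    Measurable (fun ω => (run p X f x₁ (ξ · ω) (u · ω) n).v) ∧
    Measurable (fun ω => (run p X f x₁ (ξ · ω) (u · ω) n).vhat) := by
  induction n with
  | zero => exact ⟨measurable_const, measurable_const, measurable_const, measurable_const⟩
  | succ n ih =>
    have hsub : ∀ t ∈ Finset.Icc 1 n, t ∈ Finset.Icc 1 (n + 1) := fun t ht => by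
      simp only [Finset.mem_Icc] at ht ⊢; omega
    obtain ⟨ihx, ihm, ihv, ihvh⟩ := ih (fun t ht => hξ t (hsub t ht)) (fun t ht => hu t (hsub t ht))
    have hlast : n + 1 ∈ Finset.Icc 1 (n + 1) := by simp
    have hg : Measurable fun ω => zoGrad f p.μ (run p X f x₁ (ξ · ω) (u · ω) n).x (ξ (n + 1) ω)
        (u (n + 1) ω) := measurable_zoGrad hf p.μ ihx (hξ _ hlast) (hu _ hlast)
    have hto : ∀ {h : Fin d → Ω → ℝ}, (∀ i, Measurable (h i)) →
        Measurable fun ω => (WithLp.toLp 2 fun i => h i ω : E d) := fun hh =>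
      (WithLp.measurable_toLp 2 _).comp (measurable_pi_lambda _ hh)
    have hm : Measurable fun ω => (run p X f x₁ (ξ · ω) (u · ω) (n + 1)).m :=
      (ihm.const_smul p.β₁).add (hg.const_smul (1 - p.β₁))
    have hv : Measurable fun ω => (run p X f x₁ (ξ · ω) (u · ω) (n + 1)).v :=
      hto fun i => (((measurable_coord i).comp ihv).const_mul _).add
        ((((measurable_coord i).comp hg).pow_const 2).const_mul _)
    have hvh : Measurable fun ω => (run p X f x₁ (ξ · ω) (u · ω) (n + 1)).vhat :=
      hto fun i => ((measurable_coord i).comp ihvh).max ((measurable_coord i).comp hv)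
    refine ⟨?_, hm, hv, hvh⟩
    refine measurable_weightedProj_of_le hX hXc ⟨x₁, hx₁⟩ (Real.sqrt_pos.2 hε)
      (v := fun ω => WithLp.toLp 2 fun i => √((run p X f x₁ (ξ · ω) (u · ω) (n + 1)).vhat i))
      (y := fun ω => WithLp.toLp 2 fun i => (run p X f x₁ (ξ · ω) (u · ω) n).x i -
        p.α / √((n + 1 : ℕ) : ℝ) * ((run p X f x₁ (ξ · ω) (u · ω) (n + 1)).m i /
          √((run p X f x₁ (ξ · ω) (u · ω) (n + 1)).vhat i))) ?_ ?_ ?_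
    · exact hto fun i => ((measurable_coord i).comp hvh).sqrt
    · exact hto fun i => ((measurable_coord i).comp ihx).sub
        ((((measurable_coord i).comp hm).div ((measurable_coord i).comp hvh).sqrt).const_mul _)
    · exact fun ω i => Real.sqrt_le_sqrt (run_le_vhat p X f x₁ _ _ (n + 1) i)

/-- The iterate `x_t` is independent of the fresh sample at time `t`. -/
theorem map_iter_prodMk (hX : IsCompact X) (hXc : Convex ℝ X) (hε : 0 < p.ε)
    (hf : Measurable (Function.uncurry f)) {x₁ : E d} (hx₁ : x₁ ∈ X) {Ω : Type*}
    [MeasurableSpace Ω] {Pr : Measure Ω} [IsProbabilityMeasure Pr] {ξ : ℕ → Ω → Ξ}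
    {u : ℕ → Ω → E d} (hξ : ∀ t, Measurable (ξ t)) (hu : ∀ t, Measurable (u t))
    (hindep : iIndepFun (fun t ω => (ξ t ω, u t ω)) Pr) {t : ℕ} (ht : 1 ≤ t) :
    Pr.map (fun ω => (iter p X f x₁ (ξ · ω) (u · ω) t, (ξ t ω, u t ω))) =
      (Pr.map fun ω => iter p X f x₁ (ξ · ω) (u · ω) t).prod
        (Pr.map fun ω => (ξ t ω, u t ω)) := by
  have hpair : ∀ t, Measurable fun ω => (ξ t ω, u t ω) := fun t => (hξ t).prodMk (hu t)
  have hxm : Measurable fun ω => iter p X f x₁ (ξ · ω) (u · ω) t :=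
    (measurable_run hX hXc hε hf hx₁ (t - 1) (fun t _ => hξ t) (fun t _ => hu t)).1
  rw [← indepFun_iff_map_prod_eq_prod_map_map hxm.aemeasurable (hpair t).aemeasurable]
  set 𝓜 : ℕ → MeasurableSpace Ω := fun t =>
    MeasurableSpace.comap (fun ω => (ξ t ω, u t ω)) inferInstance with h𝓜
  have hind := indep_iSup_of_disjoint (m := 𝓜) (fun t => (hpair t).comap_le) hindep
    (S := Set.Icc 1 (t - 1)) (T := {t}) (by
      rw [Set.disjoint_singleton_right, Set.mem_Icc]; omega)
  refine indep_of_indep_of_le_left (indep_of_indep_of_le_right hind ?_) ?_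
  · exact le_iSup₂_of_le t (Set.mem_singleton t) le_rfl
  · have hle : ∀ j ∈ Finset.Icc 1 (t - 1), 𝓜 j ≤ ⨆ i ∈ Set.Icc 1 (t - 1), 𝓜 i := fun j hj =>
      le_iSup₂_of_le j (by simpa using hj) le_rfl
    have hp : ∀ j ∈ Finset.Icc 1 (t - 1),
        Measurable[⨆ i ∈ Set.Icc 1 (t - 1), 𝓜 i] fun ω => (ξ j ω, u j ω) := fun j hj =>
      (comap_measurable _).mono (hle j hj) le_rfl
    -- `measurable_run` is applied again with `Ω` carrying only the σ-algebra of the first `t - 1`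
    -- pairs, so `x_t` is measurable with respect to the past.
    let _ : MeasurableSpace Ω := ⨆ i ∈ Set.Icc 1 (t - 1), 𝓜 i
    exact (measurable_run hX hXc hε hf hx₁ (t - 1) (fun j hj => (hp j hj).fst) (fun j hj => (hp j hj).snd)).1.comap_le

end Measurability

/-! ### Integrability and Fubini for a fixed query point. -/

section Expectation

open Metric

/-- Applied with `ν` the law of `x_t` and `κ` the law of the fresh pair: first moments bounded
uniformly over query points in `X` give joint integrability. -/
theorem integrable_prod_of_ae_lintegral_le {α β : Type*} [MeasurableSpace α] [MeasurableSpace β]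
    {ν : Measure α} [IsFiniteMeasure ν] {κ : Measure β} [SFinite κ] {G : Type*}
    [NormedAddCommGroup G] {h : α × β → G} (hh : AEStronglyMeasurable h (ν.prod κ)) {K : ℝ≥0∞} (hK : K ≠ ∞)
    (hle : ∀ᵐ x ∂ν, ∫⁻ y, ‖h (x, y)‖ₑ ∂κ ≤ K) : Integrable h (ν.prod κ) := by
  refine ⟨hh, ?_⟩
  rw [HasFiniteIntegral, lintegral_prod _ hh.enorm]
  refine (lintegral_mono_ae hle).trans_lt ?_
  rw [lintegral_const]
  exact ENNReal.mul_lt_top hK.lt_top (measure_lt_top _ _)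

variable {d : ℕ} {Ξ : Type*} [MeasurableSpace Ξ] {P : Measure Ξ} {X : Set (E d)}
  {μ : ℝ} {f : E d → Ξ → ℝ} {C : ℝ≥0}

theorem integrable_sample (hC : ∀ x ∈ cthickening μ X, ∫⁻ s, ‖f x s‖ₑ ∂P ≤ C)
    (hf : Measurable (Function.uncurry f)) {x : E d} (hx : x ∈ cthickening μ X) :
    Integrable (f x) P :=
  ⟨(hf.comp measurable_prodMk_left).aestronglyMeasurable, (hC x hx).trans_lt ENNReal.coe_lt_top⟩

variable [IsProbabilityMeasure P]

/-- The map `φ` treats two cases at once: `φ = id` for the perturbed query and `φ = 0` for the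
unperturbed one. -/
theorem lintegral_enorm_shift_le (hμ : 0 < μ) (hf : Measurable (Function.uncurry f))
    (hC : ∀ x ∈ cthickening μ X, ∫⁻ s, ‖f x s‖ₑ ∂P ≤ C) {ρ : Measure (E d)}
    [IsProbabilityMeasure ρ] {φ : E d → E d} (hφ : Measurable φ) (hφ1 : ∀ᵐ w ∂ρ, ‖φ w‖ ≤ 1)
    {x : E d} (hx : x ∈ X) :
    ∫⁻ y, ‖f (x + μ • φ y.2) y.1‖ₑ ∂(P.prod ρ) ≤ C := by
  have hm : Measurable fun y : Ξ × E d => ‖f (x + μ • φ y.2) y.1‖ₑ :=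
    (hf.comp ((((hφ.comp measurable_snd).const_smul μ).const_add x).prodMk
      measurable_fst)).enorm
  rw [lintegral_prod_symm _ hm.aemeasurable]
  calc _ ≤ ∫⁻ _ : E d, (C : ℝ≥0∞) ∂ρ := by
        refine lintegral_mono_ae ?_
        filter_upwards [hφ1] with w hw
        exact hC _ (add_smul_mem_cthickening hμ hx hw)
    _ = C := by simp

theorem measurable_shift (hf : Measurable (Function.uncurry f)) {φ : E d → E d}
    (hφ : Measurable φ) (x : E d) : Measurable fun y : Ξ × E d => f (x + μ • φ y.2) y.1 :=
  hf.comp ((((hφ.comp measurable_snd).const_smul μ).const_add x).prodMk measurable_fst)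

theorem integrable_shift (hμ : 0 < μ) (hf : Measurable (Function.uncurry f))
    (hC : ∀ x ∈ cthickening μ X, ∫⁻ s, ‖f x s‖ₑ ∂P ≤ C) {ρ : Measure (E d)}
    [IsProbabilityMeasure ρ] {φ : E d → E d} (hφ : Measurable φ) (hφ1 : ∀ᵐ w ∂ρ, ‖φ w‖ ≤ 1)
    {x : E d} (hx : x ∈ X) :
    Integrable (fun y : Ξ × E d => f (x + μ • φ y.2) y.1) (P.prod ρ) :=
  ⟨(measurable_shift hf hφ x).aestronglyMeasurable,
    (lintegral_enorm_shift_le hμ hf hC hφ hφ1 hx).trans_lt ENNReal.coe_lt_top⟩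

theorem measurable_smoothed (hf : Measurable (Function.uncurry f)) :
    Measurable fun q : E d × Ξ => smoothed f μ q.2 q.1 := by
  have h : Measurable fun r : (E d × Ξ) × E d => f (r.1.1 + μ • r.2) r.1.2 :=
    hf.comp ((measurable_fst.fst.add (measurable_snd.const_smul μ)).prodMk measurable_fst.snd)
  exact h.stronglyMeasurable.integral_prod_right.measurable

theorem lintegral_enorm_smoothed_le (hμ : 0 < μ) (hf : Measurable (Function.uncurry f))
    (hC : ∀ x ∈ cthickening μ X, ∫⁻ s, ‖f x s‖ₑ ∂P ≤ C) {x : E d} (hx : x ∈ X) :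
    ∫⁻ s, ‖smoothed f μ s x‖ₑ ∂P ≤ C := by
  refine le_trans ?_ (lintegral_enorm_shift_le (P := P) (ρ := unifBall d) hμ hf hC measurable_id
    ae_norm_le_one_unifBall hx)
  rw [lintegral_prod _ (measurable_shift hf measurable_id x).enorm.aemeasurable]
  exact lintegral_mono fun s => enorm_integral_le_lintegral_enorm _

theorem integral_smoothed (hμ : 0 < μ) (hf : Measurable (Function.uncurry f))
    (hC : ∀ x ∈ cthickening μ X, ∫⁻ s, ‖f x s‖ₑ ∂P ≤ C) {F : E d → ℝ}
    (hF : ∀ x, F x = ∫ s, f x s ∂P) {x : E d} (hx : x ∈ X) :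
    ∫ s, smoothed f μ s x ∂P = ∫ w, F (x + μ • w) ∂unifBall d := by
  have hint := integrable_shift (P := P) (ρ := unifBall d) hμ hf hC measurable_id
    ae_norm_le_one_unifBall hx
  simp only [hF]
  exact (integral_prod _ hint).symm.trans (integral_prod_symm _ hint)

theorem lintegral_enorm_zoGrad_le [NeZero d] (hμ : 0 < μ) (hf : Measurable (Function.uncurry f))
    (hC : ∀ x ∈ cthickening μ X, ∫⁻ s, ‖f x s‖ₑ ∂P ≤ C) {x : E d} (hx : x ∈ X) :
    ∫⁻ y, ‖zoGrad f μ x y.1 y.2‖ₑ ∂(P.prod (unifSphere d)) ≤ ‖(d : ℝ) / μ‖ₑ * (C + C) := by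
  have hone : ∀ᵐ u ∂unifSphere d, ‖u‖ ≤ 1 := by
    filter_upwards [ae_norm_eq_one_unifSphere] with u hu using hu.le
  have h1 := lintegral_enorm_shift_le (P := P) (ρ := unifSphere d) hμ hf hC measurable_id hone hx
  have h2 := lintegral_enorm_shift_le (P := P) (ρ := unifSphere d) hμ hf hC
    (measurable_const (a := (0 : E d))) (by simp) hx
  have hm1 := (measurable_shift (μ := μ) hf measurable_id x).enorm
  have hae : ∀ᵐ y ∂P.prod (unifSphere d), ‖y.2‖ = 1 :=
    Measure.quasiMeasurePreserving_snd.ae ae_norm_eq_one_unifSphere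
  calc _ ≤ ∫⁻ y, ‖(d : ℝ) / μ‖ₑ * (‖f (x + μ • id y.2) y.1‖ₑ + ‖f (x + μ • (0 : E d)) y.1‖ₑ)
        ∂(P.prod (unifSphere d)) := by
        refine lintegral_mono_ae ?_
        filter_upwards [hae] with y hy
        have hy' : ‖y.2‖ₑ = 1 := by rw [← ofReal_norm, hy, ENNReal.ofReal_one]
        rw [zoGrad, enorm_smul, enorm_mul, hy', mul_one]
        gcongr
        simpa using enorm_sub_le (a := f (x + μ • y.2) y.1) (b := f x y.1)
    _ = ‖(d : ℝ) / μ‖ₑ * (∫⁻ y, ‖f (x + μ • id y.2) y.1‖ₑ ∂(P.prod (unifSphere d)) +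
        ∫⁻ y, ‖f (x + μ • (0 : E d)) y.1‖ₑ ∂(P.prod (unifSphere d))) := by
        rw [lintegral_const_mul' _ _ enorm_ne_top, lintegral_add_left hm1]
    _ ≤ _ := by gcongr

theorem sum_mul_sub_eq_inner (g x z : E d) : ∑ i, g i * (x i - z i) = inner ℝ g (x - z) := by
  simp [PiLp.inner_apply, mul_comm]

/-- The estimator is affine in the sampled loss, so integrating over the sample first replaces `f`
by its mean `F`. -/
theorem integral_inner_zoGrad [NeZero d] (hμ : 0 < μ) (hf : Measurable (Function.uncurry f))
    (hC : ∀ x ∈ cthickening μ X, ∫⁻ s, ‖f x s‖ₑ ∂P ≤ C) {F : E d → ℝ}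
    (hF : ∀ x, F x = ∫ s, f x s ∂P) {x : E d} (hx : x ∈ X) (h : E d) :
    ∫ y, inner ℝ (zoGrad f μ x y.1 y.2) h ∂(P.prod (unifSphere d)) =
      ∫ u, (d : ℝ) / μ * (F (x + μ • u) - F x) * inner ℝ u h ∂unifSphere d := by
  have hm : Measurable fun y : Ξ × E d => zoGrad f μ x y.1 y.2 :=
    measurable_zoGrad hf μ measurable_const measurable_fst measurable_snd
  have hint : Integrable (fun y : Ξ × E d => zoGrad f μ x y.1 y.2) (P.prod (unifSphere d)) :=
    ⟨hm.aestronglyMeasurable, (lintegral_enorm_zoGrad_le hμ hf hC hx).trans_lt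
      (ENNReal.mul_lt_top enorm_lt_top (by simp))⟩
  rw [integral_prod_symm _ (hint.inner_const h)]
  refine integral_congr_ae ?_
  filter_upwards [ae_norm_eq_one_unifSphere] with u hu
  have h1 := integrable_sample hC hf (add_smul_mem_cthickening hμ hx hu.le)
  have h2 := integrable_sample hC hf (self_subset_cthickening X hx)
  simp only [zoGrad, real_inner_smul_left, hF]
  rw [integral_mul_const, integral_const_mul, integral_sub h1 h2]

end Expectation

/-! ### From conditional to total expectation. -/

section ExpectedRegret

open Metric

theorem ofReal_integral_le_lintegral_ofReal {Ω : Type*} [MeasurableSpace Ω] {Pr : Measure Ω}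
    {h : Ω → ℝ} (hh : Integrable h Pr) :
    ENNReal.ofReal (∫ ω, h ω ∂Pr) ≤ ∫⁻ ω, ENNReal.ofReal (h ω) ∂Pr := by
  rw [integral_eq_lintegral_pos_part_sub_lintegral_neg_part hh]
  refine (ENNReal.ofReal_le_ofReal (sub_le_self _ ENNReal.toReal_nonneg)).trans ?_
  exact ENNReal.ofReal_toReal_le

/-- Jensen for the square root, obtained as Hölder against the constant `1` so that infinite
integrals are allowed. -/
theorem lintegral_rpow_half_le {Ω : Type*} [MeasurableSpace Ω] {Pr : Measure Ω}
    [IsProbabilityMeasure Pr] {h : Ω → ℝ≥0∞} (hh : Measurable h) :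
    ∫⁻ ω, h ω ^ (1 / 2 : ℝ) ∂Pr ≤ (∫⁻ ω, h ω ∂Pr) ^ (1 / 2 : ℝ) := by
  have h1 := ENNReal.lintegral_mul_le_Lp_mul_Lq Pr Real.HolderConjugate.two_two
    (f := fun ω => h ω ^ (1 / 2 : ℝ)) (g := fun _ => 1) (hh.pow_const _).aemeasurable
    measurable_const.aemeasurable
  have h2 : ∀ ω, (h ω ^ (1 / 2 : ℝ)) ^ (2 : ℝ) = h ω := fun ω => by
    rw [← ENNReal.rpow_mul]; norm_num
  simpa only [Pi.mul_apply, mul_one, h2, ENNReal.one_rpow, lintegral_const, measure_univ] using h1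

variable {d : ℕ} {Ξ : Type*} {X : Set (E d)} {p : Params} {f : E d → Ξ → ℝ} {x₁ : E d}

/-- A bound linear in the `|ĝ_t|` makes `√v̂_T` integrable from first moments alone. -/
theorem sqrt_vHat_le (hβ₂0 : 0 < p.β₂) (hβ₂ : p.β₂ < 1) (hε : 0 < p.ε) (ξ : ℕ → Ξ) (u : ℕ → E d)
    (T : ℕ) (i : Fin d) :
    √(vHat p X f x₁ ξ u T i) ≤ √p.ε + ∑ t ∈ Finset.Icc 1 T, |gradEst p X f x₁ ξ u t i| := by
  set B : ℕ → ℝ := fun T => √p.ε + ∑ t ∈ Finset.Icc 1 T, |gradEst p X f x₁ ξ u t i| with hB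
  have hB0 : ∀ T, 0 ≤ B T := fun T =>
    add_nonneg (Real.sqrt_nonneg _) (Finset.sum_nonneg fun _ _ => abs_nonneg _)
  -- `v` is a convex combination of its old value and `ĝ²`, both at most `B²`; the maximum defining
  -- `v̂` then stays below the same bound.
  have key : ∀ T, (run p X f x₁ ξ u T).v i ≤ B T ^ 2 ∧ (run p X f x₁ ξ u T).vhat i ≤ B T ^ 2 := by
    intro T
    induction T with
    | zero => simp [hB, run, Real.sq_sqrt hε.le, hε.le]
    | succ T ih =>
      set a := |gradEst p X f x₁ ξ u (T + 1) i| with ha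
      have ha0 : 0 ≤ a := abs_nonneg _
      have hBs : B (T + 1) = B T + a := by
        simp only [hB, Finset.sum_Icc_succ_top (show 1 ≤ T + 1 by omega), ha]
        ring
      have hmono : B T ^ 2 ≤ B (T + 1) ^ 2 := by
        rw [hBs]
        exact pow_le_pow_left₀ (hB0 T) (by linarith) 2
      have hv : (run p X f x₁ ξ u (T + 1)).v i ≤ B (T + 1) ^ 2 := by
        have h1 : (run p X f x₁ ξ u (T + 1)).v i = p.β₂ * (run p X f x₁ ξ u T).v i +
            (1 - p.β₂) * a ^ 2 := by
          rw [ha, sq_abs]; rfl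
        have h2 : a ^ 2 ≤ B (T + 1) ^ 2 := by
          rw [hBs]
          exact pow_le_pow_left₀ ha0 (by linarith [hB0 T]) 2
        rw [h1]
        have h3 := mul_le_mul_of_nonneg_left (ih.1.trans hmono) hβ₂0.le
        have h4 := mul_le_mul_of_nonneg_left h2 (by linarith : 0 ≤ 1 - p.β₂)
        linarith
      exact ⟨hv, max_le (ih.2.trans hmono) hv⟩
  exact Real.sqrt_le_iff.2 ⟨hB0 T, (key T).2⟩

variable [MeasurableSpace Ξ] {P : Measure Ξ} [IsProbabilityMeasure P] {C : ℝ≥0} {Ω : Type*}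
  [MeasurableSpace Ω] {Pr : Measure Ω} {ξ : ℕ → Ω → Ξ} {u : ℕ → Ω → E d}

theorem measurable_iter (hX : IsCompact X) (hXc : Convex ℝ X) (hε : 0 < p.ε)
    (hf : Measurable (Function.uncurry f)) (hx₁ : x₁ ∈ X) (hξ : ∀ t, Measurable (ξ t))
    (hu : ∀ t, Measurable (u t)) (t : ℕ) :
    Measurable fun ω => iter p X f x₁ (ξ · ω) (u · ω) t :=
  (measurable_run hX hXc hε hf hx₁ (t - 1) (fun t _ => hξ t) (fun t _ => hu t)).1

theorem ae_mem_map_iter (hX : IsCompact X) (hXc : Convex ℝ X) (hε : 0 < p.ε)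
    (hf : Measurable (Function.uncurry f)) (hx₁ : x₁ ∈ X) (hξ : ∀ t, Measurable (ξ t))
    (hu : ∀ t, Measurable (u t)) (t : ℕ) :
    ∀ᵐ x ∂Pr.map (fun ω => iter p X f x₁ (ξ · ω) (u · ω) t), x ∈ X := by
  refine (ae_map_iff (measurable_iter hX hXc hε hf hx₁ hξ hu t).aemeasurable
    (p := fun x => x ∈ X) hX.isClosed.measurableSet).2 ?_
  exact Filter.Eventually.of_forall fun ω => run_x_mem hX hx₁ _ _ _

variable [IsProbabilityMeasure Pr]

theorem integrable_gradEst [NeZero d] (hX : IsCompact X) (hXc : Convex ℝ X) (hε : 0 < p.ε)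
    (hμ : 0 < p.μ) (hf : Measurable (Function.uncurry f))
    (hC : ∀ x ∈ cthickening p.μ X, ∫⁻ s, ‖f x s‖ₑ ∂P ≤ C) (hx₁ : x₁ ∈ X)
    (hξ : ∀ t, Measurable (ξ t)) (hu : ∀ t, Measurable (u t))
    (hindep : iIndepFun (fun t ω => (ξ t ω, u t ω)) Pr)
    (hlaw : ∀ t, Pr.map (fun ω => (ξ t ω, u t ω)) = P.prod (unifSphere d)) {t : ℕ} (ht : 1 ≤ t) :
    Integrable (fun ω => gradEst p X f x₁ (ξ · ω) (u · ω) t) Pr := by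
  have hxm := measurable_iter hX hXc hε hf hx₁ hξ hu t
  have hprob := Measure.isProbabilityMeasure_map (μ := Pr) hxm.aemeasurable
  have hZ : Measurable fun ω => (iter p X f x₁ (ξ · ω) (u · ω) t, (ξ t ω, u t ω)) :=
    hxm.prodMk ((hξ t).prodMk (hu t))
  have hmap := map_iter_prodMk hX hXc hε hf hx₁ hξ hu hindep ht
  rw [hlaw] at hmap
  have hm : Measurable fun q : E d × (Ξ × E d) => zoGrad f p.μ q.1 q.2.1 q.2.2 :=
    measurable_zoGrad hf p.μ measurable_fst measurable_snd.fst measurable_snd.snd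
  have hint := integrable_prod_of_ae_lintegral_le (κ := P.prod (unifSphere d))
    (K := ‖(d : ℝ) / p.μ‖ₑ * (C + C)) hm.aestronglyMeasurable (ENNReal.mul_ne_top enorm_ne_top (by simp)) (by
      filter_upwards [ae_mem_map_iter (Pr := Pr) hX hXc hε hf hx₁ hξ hu t] with x hx
      exact lintegral_enorm_zoGrad_le hμ hf hC hx)
  rw [← hmap] at hint
  exact hint.comp_measurable hZ

/-- One-step comparison: the expected smoothed loss gap is at most the expected linearized gap
along the gradient estimate. -/
theorem integral_smoothed_sub_le [NeZero d] (hX : IsCompact X) (hXc : Convex ℝ X) (hε : 0 < p.ε)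
    (hμ : 0 < p.μ) (hf : Measurable (Function.uncurry f))
    (hC : ∀ x ∈ cthickening p.μ X, ∫⁻ s, ‖f x s‖ₑ ∂P ≤ C) {F : E d → ℝ}
    (hF : ∀ x, F x = ∫ s, f x s ∂P) (hconv : ConvexOn ℝ (cthickening p.μ X) F)
    (hdiff : DifferentiableOn ℝ F (thickening p.μ X)) {K : ℝ≥0}
    (hlip : LipschitzOnWith K F (cthickening p.μ X)) {z : E d} (hz : z ∈ X) (hx₁ : x₁ ∈ X)
    (hξ : ∀ t, Measurable (ξ t)) (hu : ∀ t, Measurable (u t))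
    (hindep : iIndepFun (fun t ω => (ξ t ω, u t ω)) Pr)
    (hlaw : ∀ t, Pr.map (fun ω => (ξ t ω, u t ω)) = P.prod (unifSphere d)) {t : ℕ} (ht : 1 ≤ t) :
    Integrable (fun ω => smoothed f p.μ (ξ t ω) (iter p X f x₁ (ξ · ω) (u · ω) t) -
      smoothed f p.μ (ξ t ω) z) Pr ∧
    Integrable (fun ω => inner ℝ (gradEst p X f x₁ (ξ · ω) (u · ω) t)
      (iter p X f x₁ (ξ · ω) (u · ω) t - z)) Pr ∧
    ∫ ω, (smoothed f p.μ (ξ t ω) (iter p X f x₁ (ξ · ω) (u · ω) t) -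
      smoothed f p.μ (ξ t ω) z) ∂Pr ≤
    ∫ ω, inner ℝ (gradEst p X f x₁ (ξ · ω) (u · ω) t)
      (iter p X f x₁ (ξ · ω) (u · ω) t - z) ∂Pr := by
  have hxm := measurable_iter hX hXc hε hf hx₁ hξ hu t
  have hprob := Measure.isProbabilityMeasure_map (μ := Pr) hxm.aemeasurable
  have hZ : Measurable fun ω => (iter p X f x₁ (ξ · ω) (u · ω) t, (ξ t ω, u t ω)) :=
    hxm.prodMk ((hξ t).prodMk (hu t))
  have hmap := map_iter_prodMk hX hXc hε hf hx₁ hξ hu hindep ht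
  rw [hlaw] at hmap
  have hmem := ae_mem_map_iter (Pr := Pr) hX hXc hε hf hx₁ hξ hu t
  set ν := Pr.map fun ω => iter p X f x₁ (ξ · ω) (u · ω) t
  have hzm : Measurable fun q : E d × (Ξ × E d) => zoGrad f p.μ q.1 q.2.1 q.2.2 :=
    measurable_zoGrad hf p.μ measurable_fst measurable_snd.fst measurable_snd.snd
  set k : E d × (Ξ × E d) → ℝ := fun q => smoothed f p.μ q.2.1 q.1 - smoothed f p.μ q.2.1 z with hk
  set h : E d × (Ξ × E d) → ℝ := fun q => inner ℝ (zoGrad f p.μ q.1 q.2.1 q.2.2) (q.1 - z) with hh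
  have hkm : Measurable k :=
    ((measurable_smoothed hf).comp (measurable_fst.prodMk measurable_snd.fst)).sub
      ((measurable_smoothed hf).comp (measurable_const.prodMk measurable_snd.fst))
  have hhm : Measurable h := hzm.inner (measurable_fst.sub_const z)
  have hsm : ∀ x ∈ X, Integrable (fun s => smoothed f p.μ s x) P := fun x hx =>
    ⟨((measurable_smoothed hf).comp measurable_prodMk_left).aestronglyMeasurable,
      (lintegral_enorm_smoothed_le hμ hf hC hx).trans_lt ENNReal.coe_lt_top⟩
  have hkint : Integrable k (ν.prod (P.prod (unifSphere d))) := by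
    refine integrable_prod_of_ae_lintegral_le (K := C + C) hkm.aestronglyMeasurable (by simp) ?_
    filter_upwards [hmem] with x hx
    have hm' : Measurable fun y : Ξ × E d => ‖k (x, y)‖ₑ := (hkm.comp measurable_prodMk_left).enorm
    rw [lintegral_prod _ hm'.aemeasurable]
    simp only [hk, lintegral_const, measure_univ, mul_one]
    have hms : Measurable fun s => ‖smoothed f p.μ s x‖ₑ :=
      ((measurable_smoothed hf).comp measurable_prodMk_left).enorm
    calc _ ≤ ∫⁻ s, (‖smoothed f p.μ s x‖ₑ + ‖smoothed f p.μ s z‖ₑ) ∂P :=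
          lintegral_mono fun s => enorm_sub_le
      _ = _ := lintegral_add_left hms _
      _ ≤ _ := add_le_add (lintegral_enorm_smoothed_le hμ hf hC hx)
          (lintegral_enorm_smoothed_le hμ hf hC hz)
  have hhint : Integrable h (ν.prod (P.prod (unifSphere d))) := by
    refine integrable_prod_of_ae_lintegral_le (K := ‖(d : ℝ) / p.μ‖ₑ * (C + C) *
      ENNReal.ofReal (diam X)) hhm.aestronglyMeasurable
      (ENNReal.mul_ne_top (ENNReal.mul_ne_top enorm_ne_top (by simp)) ENNReal.ofReal_ne_top) ?_
    filter_upwards [hmem] with x hx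
    calc _ ≤ ∫⁻ y, ‖zoGrad f p.μ x y.1 y.2‖ₑ * ENNReal.ofReal (diam X)
          ∂(P.prod (unifSphere d)) := by
          refine lintegral_mono fun y => ?_
          rw [← ofReal_norm, ← ofReal_norm, ← ENNReal.ofReal_mul (norm_nonneg _)]
          refine ENNReal.ofReal_le_ofReal ((norm_inner_le_norm _ _).trans ?_)
          refine mul_le_mul_of_nonneg_left ?_ (norm_nonneg _)
          rw [← dist_eq_norm_sub]
          exact dist_le_diam_of_mem hX.isBounded hx hz
      _ = _ := lintegral_mul_const' _ _ ENNReal.ofReal_ne_top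
      _ ≤ _ := by
          gcongr
          exact lintegral_enorm_zoGrad_le hμ hf hC hx
  have hle : ∀ x ∈ X, ∫ y, k (x, y) ∂(P.prod (unifSphere d)) ≤
      ∫ y, h (x, y) ∂(P.prod (unifSphere d)) := by
    intro x hx
    have h1 : ∫ y, k (x, y) ∂(P.prod (unifSphere d)) =
        ∫ s, (smoothed f p.μ s x - smoothed f p.μ s z) ∂P := by
      have := integral_fun_fst (μ := P) (ν := unifSphere d)
        fun s => smoothed f p.μ s x - smoothed f p.μ s z
      simpa using this
    rw [h1, integral_sub (hsm x hx) (hsm z hz), integral_smoothed hμ hf hC hF hx,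
      integral_smoothed hμ hf hC hF hz]
    refine (integral_unifBall_sub_le_integral_unifSphere hμ hconv hdiff hlip hx hz).trans ?_
    exact (integral_inner_zoGrad hμ hf hC hF hx (x - z)).ge
  -- The joint law of `x_t` and the fresh pair is a product, so the inequality for fixed `x`
  -- integrates over the law of `x_t`.
  have hfinal : ∫ q, k q ∂(ν.prod (P.prod (unifSphere d))) ≤
      ∫ q, h q ∂(ν.prod (P.prod (unifSphere d))) := by
    rw [integral_prod _ hkint, integral_prod _ hhint]
    refine integral_mono_ae hkint.integral_prod_left hhint.integral_prod_left ?_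
    filter_upwards [hmem] with x hx using hle x hx
  rw [← hmap] at hkint hhint hfinal
  refine ⟨hkint.comp_measurable hZ, hhint.comp_measurable hZ, ?_⟩
  rwa [integral_map hZ.aemeasurable hkm.aestronglyMeasurable,
    integral_map hZ.aemeasurable hhm.aestronglyMeasurable] at hfinal

end ExpectedRegret

end ZOAdaMM

/-! ### Expectation of the pathwise bound. -/

theorem proposition1
    {d : ℕ} {Ξ : Type*} [MeasurableSpace Ξ] (P : Measure Ξ) [IsProbabilityMeasure P]
    (p : Params) (hα : 0 < p.α) (hβ₁0 : 0 ≤ p.β₁) (hβ₁ : p.β₁ < 1) (hβ₂0 : 0 < p.β₂)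
    (hβ₂ : p.β₂ < 1) (γ : ℝ) (hγ : γ = p.β₁ ^ 2 / p.β₂) (hγ1 : γ < 1)
    (hε : 0 < p.ε) (hμ : 0 < p.μ)
    -- the feasible set and its sup-norm diameter
    (X : Set (E d)) (hXcompact : IsCompact X) (hXconvex : Convex ℝ X)
    (D : ℝ) (hD : D = supDiam X)
    -- the sample losses `f(·; s)`, with first moments bounded on the `μ`-neighbourhood of `X`
    (f : E d → Ξ → ℝ) (hfmeas : Measurable (Function.uncurry f))
    (hfint : ∃ C : ℝ≥0, ∀ x ∈ Metric.cthickening p.μ X, ∫⁻ s, ‖f x s‖ₑ ∂P ≤ C)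
    -- the objective `F(x) = 𝔼_s f(x; s)`
    (F : E d → ℝ) (hF : ∀ x, F x = ∫ s, f x s ∂P)
    (hconv : ConvexOn ℝ (Metric.cthickening p.μ X) F)
    (L : ℝ≥0) (hsmooth : LSmoothOn L F (Metric.thickening p.μ X))
    (Lc : ℝ≥0) (hlip : LipschitzOnWith Lc F (Metric.cthickening p.μ X))
    (xstar : E d) (hxstar : xstar ∈ X) (hmin : IsMinOn F X xstar)
    (x₁ : E d) (hx₁ : x₁ ∈ X)
    -- the random samples and directions: i.i.d. pairs with law `P ⊗ Unif(sphere)`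
    {Ω : Type*} [MeasurableSpace Ω] (Pr : Measure Ω) [IsProbabilityMeasure Pr]
    (ξ : ℕ → Ω → Ξ) (u : ℕ → Ω → E d)
    (hξ : ∀ t, Measurable (ξ t)) (hu : ∀ t, Measurable (u t))
    (hindep : iIndepFun (fun t ω => (ξ t ω, u t ω)) Pr)
    (hlaw : ∀ t, Pr.map (fun ω => (ξ t ω, u t ω)) = P.prod (unifSphere d))
    (T : ℕ) (hT : 1 ≤ T) :
    Integrable (fun ω => smoothedRegret p X f x₁ (ξ · ω) (u · ω) T xstar) Pr ∧
    (∀ i, Integrable (fun ω => √(vHat p X f x₁ (ξ · ω) (u · ω) T i)) Pr) ∧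
    ENNReal.ofReal (∫ ω, smoothedRegret p X f x₁ (ξ · ω) (u · ω) T xstar ∂Pr) ≤
      ENNReal.ofReal (D ^ 2 * √(T : ℝ) / (2 * p.α * (1 - p.β₁))) *
          ∑ i, ∫⁻ ω, ENNReal.ofReal √(vHat p X f x₁ (ξ · ω) (u · ω) T i) ∂Pr +
        ENNReal.ofReal (p.α * √(1 + Real.log T) / √((1 - p.β₂) * (1 - γ))) *
          ∑ i, (∑ t ∈ Finset.Icc 1 T,
            ∫⁻ ω, ENNReal.ofReal (gradEst p X f x₁ (ξ · ω) (u · ω) t i ^ 2) ∂Pr) ^ (1 / 2 : ℝ) := by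
  obtain ⟨C, hC⟩ := hfint
  -- In dimension zero the sphere is empty and `unifSphere` is the zero measure, which cannot be a
  -- factor of a probability law.
  have hd : NeZero d := by
    refine ⟨?_⟩
    rintro rfl
    have h0 : unifSphere 0 = 0 := by
      have : (volume : Measure (E 0)).toSphere = 0 :=
        (Measure.toSphere_eq_zero_iff _).2 inferInstance
      simp [unifSphere, this, ProbabilityTheory.cond]
    have hp : IsProbabilityMeasure (Pr.map fun ω => (ξ 0 ω, u 0 ω)) :=
      Measure.isProbabilityMeasure_map ((hξ 0).prodMk (hu 0)).aemeasurable
    rw [hlaw 0, h0, Measure.prod_zero] at hp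
    have huniv := hp.measure_univ
    rw [Measure.coe_zero, Pi.zero_apply] at huniv
    exact zero_ne_one huniv
  subst hγ hD
  have hstep := fun (t : ℕ) (ht : t ∈ Finset.Icc 1 T) =>
    integral_smoothed_sub_le (P := P) (Pr := Pr) hXcompact hXconvex hε hμ hfmeas hC hF hconv
      hsmooth.1 hlip hxstar hx₁ hξ hu hindep hlaw (Finset.mem_Icc.1 ht).1
  have hgint := fun (t : ℕ) (ht : t ∈ Finset.Icc 1 T) (i : Fin d) =>
    (EuclideanSpace.proj (𝕜 := ℝ) i).integrable_comp
      (integrable_gradEst (P := P) (Pr := Pr) hXcompact hXconvex hε hμ hfmeas hC hx₁ hξ hu hindep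
        hlaw (Finset.mem_Icc.1 ht).1)
  have hvm : ∀ i, Measurable fun ω => √(vHat p X f x₁ (ξ · ω) (u · ω) T i) := fun i =>
    ((measurable_coord i).comp (measurable_run hXcompact hXconvex hε hfmeas hx₁ T
      (fun t _ => hξ t) (fun t _ => hu t)).2.2.2).sqrt
  have hgm : ∀ t i, Measurable fun ω => gradEst p X f x₁ (ξ · ω) (u · ω) t i := fun t i =>
    (measurable_coord i).comp (measurable_zoGrad hfmeas p.μ
      (measurable_iter hXcompact hXconvex hε hfmeas hx₁ hξ hu t) (hξ t) (hu t))
  refine ⟨integrable_finsetSum _ fun t ht => (hstep t ht).1, fun i => ?_, ?_⟩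
  · have hb : Integrable (fun ω => √p.ε + ∑ t ∈ Finset.Icc 1 T,
        |gradEst p X f x₁ (ξ · ω) (u · ω) t i|) Pr :=
      (integrable_const _).add (integrable_finsetSum _ fun t ht => (hgint t ht i).abs)
    refine hb.mono' (hvm i).aestronglyMeasurable (Filter.Eventually.of_forall fun ω => ?_)
    rw [Real.norm_of_nonneg (Real.sqrt_nonneg _)]
    exact sqrt_vHat_le hβ₂0 hβ₂ hε _ _ T i
  · have hpath : ∀ ω, ∑ t ∈ Finset.Icc 1 T, inner ℝ (gradEst p X f x₁ (ξ · ω) (u · ω) t)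
        (iter p X f x₁ (ξ · ω) (u · ω) t - xstar) ≤
        supDiam X ^ 2 * √(T : ℝ) / (2 * p.α * (1 - p.β₁)) *
          ∑ i, √(vHat p X f x₁ (ξ · ω) (u · ω) T i) +
        p.α * √(1 + Real.log T) / √((1 - p.β₂) * (1 - p.β₁ ^ 2 / p.β₂)) *
          ∑ i, √(∑ t ∈ Finset.Icc 1 T, gradEst p X f x₁ (ξ · ω) (u · ω) t i ^ 2) := by
      intro ω
      simp only [← sum_mul_sub_eq_inner]
      exact amsgrad_sum_inner_le (S := run p X f x₁ (ξ · ω) (u · ω))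
        (g := gradEst p X f x₁ (ξ · ω) (u · ω)) hα hβ₁0 hβ₁ hβ₂0 hβ₂ hγ1 hε hXcompact hXconvex
        hx₁ rfl rfl (fun _ => rfl) (fun _ => rfl) hxstar hT
    have hc1 : 0 ≤ supDiam X ^ 2 * √(T : ℝ) / (2 * p.α * (1 - p.β₁)) := by
      have : 0 < 1 - p.β₁ := by linarith
      positivity
    have hc2 : 0 ≤ p.α * √(1 + Real.log T) / √((1 - p.β₂) * (1 - p.β₁ ^ 2 / p.β₂)) := by
      positivity
    set c₁ := supDiam X ^ 2 * √(T : ℝ) / (2 * p.α * (1 - p.β₁))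
    set c₂ := p.α * √(1 + Real.log T) / √((1 - p.β₂) * (1 - p.β₁ ^ 2 / p.β₂))
    have hgsm : ∀ i, Measurable fun ω =>
        ∑ t ∈ Finset.Icc 1 T, gradEst p X f x₁ (ξ · ω) (u · ω) t i ^ 2 := fun i =>
      Finset.measurable_fun_sum _ fun t _ => (hgm t i).pow_const 2
    have hjensen : ∀ i, ∫⁻ ω, ENNReal.ofReal √(∑ t ∈ Finset.Icc 1 T,
        gradEst p X f x₁ (ξ · ω) (u · ω) t i ^ 2) ∂Pr ≤ (∑ t ∈ Finset.Icc 1 T,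
          ∫⁻ ω, ENNReal.ofReal (gradEst p X f x₁ (ξ · ω) (u · ω) t i ^ 2) ∂Pr) ^ (1 / 2 : ℝ) := by
      intro i
      simp only [Real.sqrt_eq_rpow]
      calc _ = ∫⁻ ω, ENNReal.ofReal (∑ t ∈ Finset.Icc 1 T,
            gradEst p X f x₁ (ξ · ω) (u · ω) t i ^ 2) ^ (1 / 2 : ℝ) ∂Pr :=
            lintegral_congr fun ω => (ENNReal.ofReal_rpow_of_nonneg
              (Finset.sum_nonneg fun _ _ => sq_nonneg _) (by norm_num)).symm
        _ ≤ _ := lintegral_rpow_half_le (hgsm i).ennreal_ofReal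
        _ = _ := by
          rw [← lintegral_finsetSum _ fun t _ => ((hgm t i).pow_const 2).ennreal_ofReal]
          simp only [ENNReal.ofReal_sum_of_nonneg fun _ _ => sq_nonneg _]
    calc ENNReal.ofReal (∫ ω, smoothedRegret p X f x₁ (ξ · ω) (u · ω) T xstar ∂Pr)
        ≤ ENNReal.ofReal (∫ ω, ∑ t ∈ Finset.Icc 1 T,
            inner ℝ (gradEst p X f x₁ (ξ · ω) (u · ω) t)
              (iter p X f x₁ (ξ · ω) (u · ω) t - xstar) ∂Pr) := by
          refine ENNReal.ofReal_le_ofReal ?_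
          simp only [smoothedRegret]
          rw [integral_finsetSum _ fun t ht => (hstep t ht).1,
            integral_finsetSum _ fun t ht => (hstep t ht).2.1]
          exact Finset.sum_le_sum fun t ht => (hstep t ht).2.2
      _ ≤ ∫⁻ ω, ENNReal.ofReal (∑ t ∈ Finset.Icc 1 T,
            inner ℝ (gradEst p X f x₁ (ξ · ω) (u · ω) t)
              (iter p X f x₁ (ξ · ω) (u · ω) t - xstar)) ∂Pr :=
          ofReal_integral_le_lintegral_ofReal
            (integrable_finsetSum _ fun t ht => (hstep t ht).2.1)
      _ ≤ ∫⁻ ω, (ENNReal.ofReal c₁ * ∑ i, ENNReal.ofReal √(vHat p X f x₁ (ξ · ω) (u · ω) T i) +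
            ENNReal.ofReal c₂ * ∑ i, ENNReal.ofReal √(∑ t ∈ Finset.Icc 1 T,
              gradEst p X f x₁ (ξ · ω) (u · ω) t i ^ 2)) ∂Pr := by
          refine lintegral_mono fun ω => (ENNReal.ofReal_le_ofReal (hpath ω)).trans ?_
          refine ENNReal.ofReal_add_le.trans (le_of_eq ?_)
          rw [ENNReal.ofReal_mul hc1, ENNReal.ofReal_mul hc2,
            ENNReal.ofReal_sum_of_nonneg fun _ _ => Real.sqrt_nonneg _,
            ENNReal.ofReal_sum_of_nonneg fun _ _ => Real.sqrt_nonneg _]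
      _ = ENNReal.ofReal c₁ * ∑ i, ∫⁻ ω, ENNReal.ofReal √(vHat p X f x₁ (ξ · ω) (u · ω) T i) ∂Pr +
            ENNReal.ofReal c₂ * ∑ i, ∫⁻ ω, ENNReal.ofReal √(∑ t ∈ Finset.Icc 1 T,
              gradEst p X f x₁ (ξ · ω) (u · ω) t i ^ 2) ∂Pr := by
          have hm1 : ∀ i ∈ Finset.univ, Measurable fun ω =>
              ENNReal.ofReal √(vHat p X f x₁ (ξ · ω) (u · ω) T i) :=
            fun i _ => (hvm i).ennreal_ofReal
          have hm2 : ∀ i ∈ Finset.univ, Measurable fun ω => ENNReal.ofReal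
              √(∑ t ∈ Finset.Icc 1 T, gradEst p X f x₁ (ξ · ω) (u · ω) t i ^ 2) :=
            fun i _ => (hgsm i).sqrt.ennreal_ofReal
          rw [lintegral_add_left ((Finset.measurable_fun_sum _ hm1).const_mul _),
            lintegral_const_mul' _ _ ENNReal.ofReal_ne_top,
            lintegral_const_mul' _ _ ENNReal.ofReal_ne_top,
            lintegral_finsetSum _ hm1, lintegral_finsetSum _ hm2]
      _ ≤ _ := by
          gcongr with i _
          exact hjensen i
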